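/- For $A=[a_1\cdots a_R]\in\mathbb R^{I\times R}$, $B=[b_1\cdots b_R]\in\mathbb R^{J\times R}$, $C=[c_1\cdots c_R]\in\mathbb R^{K\times R}$ let $[A,B,C]_R=\sum_{r=1}^R a_r\circ b_r\circ c_r\in\mathbb R^{I\times J\times K}$, i.e. $([A,B,C]_R)_{ijk}=\sum_{r} A_{ir}B_{jr}C_{kr}$. The rank $r_{\mathcal T}$ of a tensor $\mathcal T$ is the least $R$ for which $\mathcal T=[A,B,C]_R$ for some $A,B,C$; if $R=r_{\mathcal T}$, then $\mathcal T=[A,B,C]_R$ is called a canonical polyadic decomposition (CPD) of $\mathcal T$. The CPD of $\mathcal T$ is unique if any two CPDs of $\mathcal T$ differ only by a permutation of the rank-one terms and by scalings of the three vectors inside each term whose product is $1$. Let $r_X$ be the rank of a matrix $X$, and let $k_X$ (its $k$-rank) be the largest $k$, at most the number of columns of $X$, such that every set of $k$ columns of $X$ is linearly independent. By an algebraic algorithm we mean a finite program that works with real matrices and uses only the following operations: rational constant matrices, sums, products, transposes, Kronecker products, rearrangements of entries (in particular submatrices, vectorization, matricization), inverses, matrices of minors (compound matrices), case distinctions on the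 rank of a computed matrix, computation of a basis of the orthogonal complement of the column space of a matrix, and computation of a real generalized eigenvalue decomposition (GEVD) of a regular square matrix pencil $(P,Q)$, i.e. of an invertible $V$ and diagonal $D_\alpha,D_\beta$ with $(\alpha_i,\beta_i)\neq(0,0)$ for all $i$ and $PVD_\beta=QVD_\alpha$. The algorithm has to succeed whichever basis and whichever GEVD is returned, and whatever is returned by a call for which no correct result exists. **Corollary.** Let $\mathcal T=[A,B,C]_R$ with $A\in\mathbb R^{I\times R}$, $B\in\mathbb R^{J\times R}$, $C\in\mathbb R^{K\times R}$, and suppose that $$k_A+r_B+k_C\ \ge\ 2R+2\qquad\text{and}\qquad k_B+k_C\ \ge\ R+2 .$$ Then $r_{\mathcal T}=R$, and the CPD of $\mathcal T$ is unique and can be found algebraically. The last claim means: for all $I,J,K,R$ there is an algebraic algorithm which, given as its only input any tensor $\mathcal T\in\mathbb R^{I\times J\times K}$ that has the form $[A,B,C]_R$ for some (unknown) $A,B,C$ satisfying the two inequalities, outputs the factor matrices of a CPD of $\mathcal T$ with $R$ terms. -/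

import Mathlib

open scoped Kronecker

namespace CPDecomp

/-! ## Third-order tensors, polyadic decompositions, rank, k-rank -/

/-- Real third-order tensors of format `I × J × K`. -/
abbrev Tensor (I J K : ℕ) : Type := Fin I → Fin J → Fin K → ℝ

/-- The polyadic decomposition `[A, B, C]_R`, that is the sum over `r` of the outer products
`a_r ∘ b_r ∘ c_r` of the columns of the factor matrices. -/
def polyadic {I J K R : ℕ} (A : Matrix (Fin I) (Fin R) ℝ) (B : Matrix (Fin J) (Fin R) ℝ)
    (C : Matrix (Fin K) (Fin R) ℝ) : Tensor I J K :=
  fun i j k => ∑ r, A i r * B j r * C k r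

/-- The rank of a tensor: the minimal number of terms in a polyadic decomposition. (A term with
a zero vector can be dropped, so requiring nonzero vectors would not change the minimum.) -/
noncomputable def tensorRank {I J K : ℕ} (T : Tensor I J K) : ℕ :=
  sInf {R : ℕ | ∃ (A : Matrix (Fin I) (Fin R) ℝ) (B : Matrix (Fin J) (Fin R) ℝ)
    (C : Matrix (Fin K) (Fin R) ℝ), T = polyadic A B C}

/-- `T = [A, B, C]_R` is a canonical polyadic decomposition: the number of terms is minimal. -/
def IsCPD {I J K R : ℕ} (T : Tensor I J K) (A : Matrix (Fin I) (Fin R) ℝ)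
    (B : Matrix (Fin J) (Fin R) ℝ) (C : Matrix (Fin K) (Fin R) ℝ) : Prop :=
  T = polyadic A B C ∧ R = tensorRank T

/-- Two triples of factor matrices agree up to a permutation of the rank-1 terms and a scaling of
the vectors within each term that leaves the term unchanged. -/
def TriviallyEquivalent {I J K R : ℕ}
    (A : Matrix (Fin I) (Fin R) ℝ) (B : Matrix (Fin J) (Fin R) ℝ) (C : Matrix (Fin K) (Fin R) ℝ)
    (A' : Matrix (Fin I) (Fin R) ℝ) (B' : Matrix (Fin J) (Fin R) ℝ)
    (C' : Matrix (Fin K) (Fin R) ℝ) : Prop :=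
  ∃ (π : Equiv.Perm (Fin R)) (a b c : Fin R → ℝ),
    (∀ r, a r * b r * c r = 1) ∧
    (∀ i r, A' i r = a r * A i (π r)) ∧
    (∀ j r, B' j r = b r * B j (π r)) ∧
    (∀ k r, C' k r = c r * C k (π r))

/-- The CPD of `T` is unique: it is only subject to the trivial indeterminacies. -/
def CPDUnique {I J K : ℕ} (T : Tensor I J K) : Prop :=
  ∀ (R : ℕ) (A A' : Matrix (Fin I) (Fin R) ℝ) (B B' : Matrix (Fin J) (Fin R) ℝ)
    (C C' : Matrix (Fin K) (Fin R) ℝ),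
    IsCPD T A B C → IsCPD T A' B' C' → TriviallyEquivalent A B C A' B' C'

/-- The k-rank of a matrix: the largest `k` (at most the number of columns) such that every
set of `k` columns is linearly independent. -/
noncomputable def kRank {m n : ℕ} (A : Matrix (Fin m) (Fin n) ℝ) : ℕ :=
  sSup {k : ℕ | k ≤ n ∧ ∀ S : Finset (Fin n), S.card = k →
    LinearIndependent ℝ (fun j : S => A.col j)}

/-- The matrix unfolding of `T`: the `IJ × K` matrix whose `k`-th column lists the entries of the
`k`-th frontal slice row after row; `[A, B, C]_R` unfolds to `(A ⊙ B) Cᵀ`. -/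
def unfolding {I J K : ℕ} (T : Tensor I J K) : Matrix (Fin (I * J)) (Fin K) ℝ :=
  Matrix.of fun x k => T (finProdFinEquiv.symm x).1 (finProdFinEquiv.symm x).2 k

/-! ## The two subroutines whose result is not unique -/

/-- The columns of `N` form a basis of the orthogonal complement of the column space of `A`. -/
def IsOrthComplBasis {m n d : ℕ} (A : Matrix (Fin m) (Fin n) ℝ)
    (N : Matrix (Fin m) (Fin d) ℝ) : Prop :=
  LinearIndependent ℝ N.col ∧
    ∀ v : Fin m → ℝ, v ∈ Submodule.span ℝ (Set.range N.col) ↔ ∀ j, A.col j ⬝ᵥ v = 0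

/-- A (real) generalized eigenvalue decomposition of the regular `n × n` matrix pencil `(P, Q)`:
the columns `v_i` of `V` form a basis of generalized eigenvectors and `(α_i, β_i) ≠ (0, 0)` are
the associated eigenvalues in homogeneous form, so that `β_i P v_i = α_i Q v_i`. -/
def IsGEVD {n : ℕ} (P Q V : Matrix (Fin n) (Fin n) ℝ) (α β : Fin n → ℝ) : Prop :=
  (∃ s t : ℝ, (s • P + t • Q).det ≠ 0) ∧
    V.det ≠ 0 ∧ (∀ i, α i ≠ 0 ∨ β i ≠ 0) ∧
    P * V * Matrix.diagonal β = Q * V * Matrix.diagonal α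

/-! ## Algebraic algorithms

An algebraic algorithm is a finite program that works on real matrices stored in registers. It
uses basic matrix operations, matrices of minors (compound matrices), case distinctions on the rank
of a matrix, bases of orthogonal complements, and generalized eigenvalue decompositions. -/

/-- Matrix expressions. The register with the name `k` for `m × n` matrices is `reg m n k`. -/
inductive MatExpr : ℕ → ℕ → Type
  /-- the content of a register -/
  | reg (m n k : ℕ) : MatExpr m n
  /-- a fixed rational matrix -/
  | const {m n : ℕ} (M : Matrix (Fin m) (Fin n) ℚ) : MatExpr m n
  /-- sum -/
  | add {m n : ℕ} (e f : MatExpr m n) : MatExpr m n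
  /-- matrix product -/
  | mul {m n p : ℕ} (e : MatExpr m n) (f : MatExpr n p) : MatExpr m p
  /-- transpose -/
  | transpose {m n : ℕ} (e : MatExpr m n) : MatExpr n m
  /-- Kronecker product -/
  | kron {m n p q : ℕ} (e : MatExpr m n) (f : MatExpr p q) : MatExpr (m * p) (n * q)
  /-- rearrangement of entries (submatrices, vectorization, matricization, tensorization):
  the `(i, j)` entry of the result is the entry with index `s i j` of the argument -/
  | rearrange {m n p q : ℕ} (s : Fin p → Fin q → Fin m × Fin n) (e : MatExpr m n) : MatExpr p q
  /-- inverse of a square matrix (the zero matrix if the argument is singular) -/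
  | inv {n : ℕ} (e : MatExpr n n) : MatExpr n n
  /-- minors of order `k` for the listed selections of rows and of columns; if `rows` and `cols`
  list all increasing sequences lexicographically, this is the `k`-th compound matrix -/
  | minors {m n p q k : ℕ} (rows : Fin p → Fin k → Fin m) (cols : Fin q → Fin k → Fin n)
      (e : MatExpr m n) : MatExpr p q

/-- A memory state: the contents of all registers. -/
abbrev State : Type := (m n : ℕ) → ℕ → Matrix (Fin m) (Fin n) ℝ

/-- Store the matrix `M` in the register `reg m n k`. -/
def State.store (σ : State) (m n k : ℕ) (M : Matrix (Fin m) (Fin n) ℝ) : State :=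
  Function.update σ m (Function.update (σ m) n (Function.update (σ m n) k M))

/-- The value of a matrix expression. -/
noncomputable def MatExpr.eval (σ : State) : {m n : ℕ} → MatExpr m n → Matrix (Fin m) (Fin n) ℝ
  | _, _, .reg m n k => σ m n k
  | _, _, .const M => M.map (fun x : ℚ => (x : ℝ))
  | _, _, .add e f => e.eval σ + f.eval σ
  | _, _, .mul e f => e.eval σ * f.eval σ
  | _, _, .transpose e => (e.eval σ).transpose
  | _, _, .kron e f =>
      ((e.eval σ) ⊗ₖ (f.eval σ)).reindex finProdFinEquiv finProdFinEquiv
  | _, _, .rearrange s e => Matrix.of fun i j => e.eval σ (s i j).1 (s i j).2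
  | _, _, .inv e => (e.eval σ)⁻¹
  | _, _, .minors rows cols e =>
      Matrix.of fun i j => ((e.eval σ).submatrix (rows i) (cols j)).det

/-- Programs. -/
inductive Program : Type
  /-- do nothing -/
  | skip : Program
  /-- `reg m n k := e` -/
  | assign {m n : ℕ} (k : ℕ) (e : MatExpr m n) : Program
  /-- `reg m d k :=` a basis of the orthogonal complement of the column space of `e` -/
  | orthCompl {m n : ℕ} (d k : ℕ) (e : MatExpr m n) : Program
  /-- compute a GEVD of the pencil `(e, f)`; the eigenvectors are stored in `reg n n v`, the
  eigenvalues in the diagonal matrices `reg n n a` and `reg n n b` -/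
  | gevd {n : ℕ} (v a b : ℕ) (e f : MatExpr n n) : Program
  /-- run `p` if the rank of `e` is `r`, otherwise run `q` -/
  | ifRank {m n : ℕ} (e : MatExpr m n) (r : ℕ) (p q : Program) : Program
  /-- run `p`, then `q` -/
  | seq (p q : Program) : Program

/-- `p.Exec σ τ`: the program `p`, started in the state `σ`, can end in the state `τ`.
The subroutines `orthCompl` and `gevd` may return any correct result. Where no correct result
exists (wrong dimension, or a pencil without a real GEVD) they may return anything at all. -/
def Program.Exec : Program → State → State → Prop
  | .skip, σ, τ => τ = σ
  | @Program.assign m n k e, σ, τ => τ = σ.store m n k (e.eval σ)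
  | @Program.orthCompl m _ d k e, σ, τ =>
      ∃ N : Matrix (Fin m) (Fin d) ℝ,
        ((∃ N' : Matrix (Fin m) (Fin d) ℝ, IsOrthComplBasis (e.eval σ) N') →
          IsOrthComplBasis (e.eval σ) N) ∧
        τ = σ.store m d k N
  | @Program.gevd n v a b e f, σ, τ =>
      ∃ (V : Matrix (Fin n) (Fin n) ℝ) (α β : Fin n → ℝ),
        ((∃ (V' : Matrix (Fin n) (Fin n) ℝ) (α' β' : Fin n → ℝ),
            IsGEVD (e.eval σ) (f.eval σ) V' α' β') →
          IsGEVD (e.eval σ) (f.eval σ) V α β) ∧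
        τ = ((σ.store n n v V).store n n a (Matrix.diagonal α)).store n n b (Matrix.diagonal β)
  | .ifRank e r p q, σ, τ =>
      ((e.eval σ).rank = r ∧ p.Exec σ τ) ∨ ((e.eval σ).rank ≠ r ∧ q.Exec σ τ)
  | .seq p q, σ, τ => ∃ ρ, p.Exec σ ρ ∧ q.Exec ρ τ

/-- The initial state for the input `T`: the register `0` for `IJ × K` matrices contains the
unfolding of `T`, and all other registers contain zero matrices. -/
def initialState {I J K : ℕ} (T : Tensor I J K) : State :=
  State.store (fun _ _ _ => 0) (I * J) K 0 (unfolding T)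

/-- The program `p` finds a CPD of `T` with `R` terms: every run (and there is one) that starts
from `T` alone ends with the factor matrices of a CPD of `T` in the registers `1`, `2`, `3`. -/
def Program.FindsCPD {I J K : ℕ} (p : Program) (R : ℕ) (T : Tensor I J K) : Prop :=
  (∃ τ, p.Exec (initialState T) τ) ∧
    ∀ τ, p.Exec (initialState T) τ → IsCPD T (τ I R 1) (τ J R 2) (τ K R 3)

/-- For the `I × J × K` tensors in the class `S`, the CPD with `R` terms can be found
algebraically: one and the same program finds it for all of them. -/
def CPDFoundAlgebraically {I J K : ℕ} (R : ℕ) (S : Set (Tensor I J K)) : Prop :=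
  ∃ p : Program, ∀ T ∈ S, p.FindsCPD R T

end CPDecomp

namespace CPDecomp

open Matrix

/-! Put q = k_C − 1 and p = R − q. The two inequalities become R + (p+1) ≤ k_A + r_B and p+1 ≤ k_B.
Of A and B only one consequence is used, `Separates (p + 1) A B`: any p+1 terms of A diag(d) Bᵀ can
be isolated by multiplication from both sides (`separates_of_kRank`). Hence A diag(d) Bᵀ has rank at
least min(weight d, p+1), and the matrices a_r b_rᵀ are linearly independent. The third mode is
projected to q+1 dimensions such that any q+1 of the vectors c_r form a basis.

Rank and uniqueness follow Kruskal: comparing the slices of two decompositions bounds weights, the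
permutation lemma `exists_perm_of_weight_le` matches the c_r, and `exists_col_proportional` matches
the other factors.

The algorithm looks for the points x_W orthogonal to the c_r with r ∈ W, for the q-element sets W.
There the slice M(y) = A diag(c_r·y) Bᵀ has rank at most p, so its (p+1)-minors vanish. The minors
also span all products of p+1 distinct linear forms c_r·y. A dimension count shows that modulo
minors a form of degree p+1 is determined by its values at the x_W. Multiplication by a linear form
ℓ, from degree p into this quotient, is therefore diag(ℓ·x_W) F up to a change of basis, F being the
invertible matrix of the monomials at the x_W (`exists_pencil_factorization`). A GEVD for two
suitable ℓ yields the x_W up to scaling. Slices at two points whose sets W differ by one exchange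
give columns of A and B by Cramer's rule (`exists_recoverCol`), and C solves a linear system.

The projection, the forms ℓ and the minors depend on the unknown factors, but range over finite sets
fixed in advance. The program tries all of them and accepts a candidate only if it reproduces the
tensor exactly (`exists_program_of_stage_list`). -/

/-! ### k-rank, dual families and multilinearity of determinants -/

theorem kRank_mem {m n : ℕ} (A : Matrix (Fin m) (Fin n) ℝ) :
    kRank A ≤ n ∧ ∀ S : Finset (Fin n), S.card = kRank A →
      LinearIndependent ℝ (fun j : S => A.col j) := by
  have := Nat.sSup_mem (s := {k : ℕ | k ≤ n ∧ ∀ S : Finset (Fin n), S.card = k →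
    LinearIndependent ℝ (fun j : S => A.col j)}) ⟨0, Nat.zero_le _, fun S hS => by
      have : IsEmpty S := by
        rw [Finset.card_eq_zero] at hS; subst hS; infer_instance
      exact linearIndependent_empty_type⟩ ⟨n, fun k hk => hk.1⟩
  exact this

theorem linearIndepOn_of_card_le_kRank {m n : ℕ} (A : Matrix (Fin m) (Fin n) ℝ)
    (S : Finset (Fin n)) (hS : S.card ≤ kRank A) : LinearIndepOn ℝ A.col (S : Set (Fin n)) := by
  obtain ⟨h1, h2⟩ := kRank_mem A
  obtain ⟨S', hSS', hc⟩ := Finset.exists_superset_card_eq (s := S) (n := kRank A) hS (by simpa using h1)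
  have := h2 S' hc
  have h3 : LinearIndepOn ℝ A.col (S' : Set (Fin n)) := this
  exact h3.mono (by simpa using hSS')

/-- A left inverse of the linear-combination map returns coordinates; the coordinate functionals,
written as dot products, are the dual vectors. -/
theorem exists_dual_family {ι : Type*} {n : ℕ} (v : ι → Fin n → ℝ) (s : Set ι)
    (h : LinearIndepOn ℝ v s) [DecidableEq ι] :
    ∃ u : ι → Fin n → ℝ, ∀ i ∈ s, ∀ j ∈ s, u i ⬝ᵥ v j = if i = j then 1 else 0 := by
  have h' : LinearIndependent ℝ (fun i : s => v i) := h
  obtain ⟨g, hg⟩ := LinearMap.exists_leftInverse_of_injective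
    (Finsupp.linearCombination ℝ (fun i : s => v i)) (LinearMap.ker_eq_bot.2 h')
  classical
  refine ⟨fun i => if hi : i ∈ s then fun k => g (Pi.single k 1) ⟨i, hi⟩ else 0, ?_⟩
  intro i hi j hj
  have h1 : g (v j) ⟨i, hi⟩ = if i = j then 1 else 0 := by
    have := LinearMap.congr_fun hg (Finsupp.single ⟨j, hj⟩ 1)
    simp only [LinearMap.comp_apply, Finsupp.linearCombination_single, one_smul,
      LinearMap.id_apply] at this
    rw [this, Finsupp.single_apply]
    simp [Subtype.ext_iff, eq_comm]
  rw [← h1]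
  have h2 : v j = ∑ k, v j k • (Pi.single k (1 : ℝ) : Fin n → ℝ) := by
    ext k; simp [Finset.sum_apply, Pi.single_apply]
  conv_rhs => rw [h2]
  simp only [dif_pos hi, dotProduct, map_sum, map_smul, Finsupp.coe_finsetSum, Finset.sum_apply,
    Finsupp.smul_apply, smul_eq_mul]
  exact Finset.sum_congr rfl fun k _ => mul_comm _ _

theorem exists_ne_zero_dotProduct_eq_zero {ι κ : Type*} [Fintype κ] (v : ι → κ → ℝ) (s : Finset ι)
    (h : s.card < Fintype.card κ) : ∃ x : κ → ℝ, x ≠ 0 ∧ ∀ i ∈ s, v i ⬝ᵥ x = 0 := by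
  let f : (κ → ℝ) →ₗ[ℝ] (s → ℝ) := Matrix.mulVecLin (Matrix.of fun i : s => v i)
  have := f.ker_ne_bot_of_finrank_lt (by simpa using h)
  obtain ⟨x, hx, hx0⟩ := Submodule.exists_mem_ne_zero_of_ne_bot this
  exact ⟨x, hx0, fun i hi => congrFun (LinearMap.mem_ker.1 hx) ⟨i, hi⟩⟩

/-- If the determinant of a matrix whose columns are linear combinations of given vectors is
nonzero, it remains nonzero for some choice of one of the vectors for each column. -/
theorem exists_selection_det_ne_zero {n : Type*} [Fintype n] [DecidableEq n] {α : n → Type*}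
    [∀ i, Fintype (α i)] (g : ∀ q, α q → ℝ) (w : ∀ q, α q → n → ℝ)
    (h : (Matrix.of fun a q => ∑ j, g q j * w q j a).det ≠ 0) :
    ∃ Q : ∀ q, α q, (Matrix.of fun a q => w q (Q q) a).det ≠ 0 := by
  by_contra hcon
  push Not at hcon
  apply h
  rw [← det_transpose]
  have e1 : (Matrix.of fun a q => ∑ j, g q j * w q j a)ᵀ = fun q => ∑ j, g q j • w q j := by
    ext q a; simp [Finset.sum_apply]
  rw [e1]
  have := (detRowAlternating (R := ℝ) (n := n)).toMultilinearMap.map_sum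
    (fun q j => g q j • w q j)
  refine Eq.trans this ?_
  apply Finset.sum_eq_zero
  intro Q _
  refine Eq.trans (MultilinearMap.map_smul_univ _ (fun q => g q (Q q)) (fun q => w q (Q q))) ?_
  have h2 := hcon Q
  rw [← det_transpose] at h2
  have h3 : (detRowAlternating (R := ℝ) (n := n)).toMultilinearMap (fun q => w q (Q q)) = 0 := h2
  rw [h3, smul_zero]

/-! ### Separation of rank-one terms -/

/-- The matrix `A diag(d) Bᵀ`, i.e. the sum of the `d r • a_r b_rᵀ`. -/
def weighted {I J R : ℕ} (A : Matrix (Fin I) (Fin R) ℝ) (B : Matrix (Fin J) (Fin R) ℝ)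
    (d : Fin R → ℝ) : Matrix (Fin I) (Fin J) ℝ :=
  Matrix.of fun i j => ∑ r, d r * A i r * B j r

theorem weighted_eq {I J R : ℕ} (A : Matrix (Fin I) (Fin R) ℝ) (B : Matrix (Fin J) (Fin R) ℝ)
    (d : Fin R → ℝ) : weighted A B d = A * diagonal d * Bᵀ := by
  ext i j
  rw [Matrix.mul_apply]
  simp only [weighted, of_apply, mul_diagonal, transpose_apply]
  exact Finset.sum_congr rfl fun r _ => by ring

theorem weighted_transpose {I J R : ℕ} (A : Matrix (Fin I) (Fin R) ℝ) (B : Matrix (Fin J) (Fin R) ℝ)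
    (d : Fin R → ℝ) : (weighted A B d)ᵀ = weighted B A d := by
  ext i j
  simp only [weighted, of_apply, transpose_apply]
  exact Finset.sum_congr rfl fun r _ => by ring

/-- For any `m` indices, `A` and `B` can be multiplied from the left such that these columns become
the unit vectors and that all other terms of `weighted A B d` are cancelled. -/
def Separates {I J R : ℕ} (m : ℕ) (A : Matrix (Fin I) (Fin R) ℝ)
    (B : Matrix (Fin J) (Fin R) ℝ) : Prop :=
  ∀ e : Fin m → Fin R, Function.Injective e →
    ∃ (U : Matrix (Fin m) (Fin I) ℝ) (V : Matrix (Fin m) (Fin J) ℝ),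
      (∀ d, U * weighted A B d * Vᵀ = diagonal (fun i => d (e i))) ∧
      (∀ a i, (U * A) a (e i) = if a = i then 1 else 0) ∧
      (∀ a i, (V * B) a (e i) = if a = i then 1 else 0)

theorem Separates.swap {I J R m : ℕ} {A : Matrix (Fin I) (Fin R) ℝ}
    {B : Matrix (Fin J) (Fin R) ℝ} (h : Separates m A B) : Separates m B A := by
  intro e he
  obtain ⟨U, V, h1, h2, h3⟩ := h e he
  refine ⟨V, U, fun d => ?_, h3, h2⟩
  have := congrArg Matrix.transpose (h1 d)
  rwa [transpose_mul, transpose_mul, transpose_transpose, diagonal_transpose, weighted_transpose,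
    ← Matrix.mul_assoc] at this

/-- The chosen columns of B extend to a basis Z of its column space. The rows of V are dual to Z,
those of U are dual to the columns of A indexed by Zᶜ ∪ S. A term r outside S is killed by V if r ∈
Z and by U otherwise. -/
theorem separates_of_kRank {I J R m : ℕ} (A : Matrix (Fin I) (Fin R) ℝ)
    (B : Matrix (Fin J) (Fin R) ℝ) (hAB : R + m ≤ kRank A + B.rank) (hB : m ≤ kRank B) :
    Separates m A B := by
  classical
  intro e he
  set S : Finset (Fin R) := Finset.univ.image e with hSdef
  have hScard : S.card = m := by
    rw [hSdef, Finset.card_image_of_injective _ he, Finset.card_univ, Fintype.card_fin]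
  have heS : ∀ i, e i ∈ S := fun i => Finset.mem_image_of_mem _ (Finset.mem_univ _)
  have hBS := linearIndepOn_of_card_le_kRank B S (by omega)
  obtain ⟨Z, -, hSZ, hZspan, hZ⟩ := exists_linearIndepOn_extension hBS (Set.subset_univ _)
  have hZrank : B.rank = Z.toFinset.card := by
    rw [rank_eq_finrank_span_cols]
    have : Submodule.span ℝ (Set.range B.col) = Submodule.span ℝ (B.col '' Z) := by
      apply le_antisymm
      · rw [Submodule.span_le, ← Set.image_univ]; exact hZspan
      · exact Submodule.span_mono (Set.image_subset_range _ _)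
    rw [this, finrank_span_set_eq_card]
    · rw [Set.toFinset_image, Finset.card_image_of_injOn]
      simpa using hZ.injOn
    · exact hZ.id_image
  -- The first inequality enters here: |Zᶜ ∪ S| ≤ (R − r_B) + m ≤ k_A.
  have hcardc : (Z.toFinsetᶜ ∪ S).card ≤ kRank A := by
    have h1 := Finset.card_union_le Z.toFinsetᶜ S
    have h2 := Finset.card_compl Z.toFinset
    have h3 := Finset.card_le_univ Z.toFinset
    simp only [Fintype.card_fin] at h2 h3
    omega
  obtain ⟨u, hu⟩ := exists_dual_family A.col _ (linearIndepOn_of_card_le_kRank A _ hcardc)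
  obtain ⟨v, hv⟩ := exists_dual_family B.col _ hZ
  have heZ : ∀ i, e i ∈ Z := fun i => hSZ (heS i)
  have hUA : ∀ a r, r ∉ Z ∨ r ∈ S → ((Matrix.of fun i => u (e i)) * A : Matrix (Fin m) _ ℝ) a r =
      if e a = r then 1 else 0 := by
    intro a r hr
    refine Eq.trans ?_ (hu (e a) (by simp [heS]) r (by simpa using hr))
    rfl
  have hVB : ∀ a r, r ∈ Z → ((Matrix.of fun i => v (e i)) * B : Matrix (Fin m) _ ℝ) a r =
      if e a = r then 1 else 0 := by
    intro a r hr
    exact Eq.trans rfl (hv (e a) (heZ _) r hr)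
  refine ⟨Matrix.of fun i => u (e i), Matrix.of fun i => v (e i), fun d => ?_, fun a i => ?_,
    fun a i => ?_⟩
  · rw [weighted_eq]
    set U : Matrix (Fin m) (Fin I) ℝ := Matrix.of fun i => u (e i)
    set V : Matrix (Fin m) (Fin J) ℝ := Matrix.of fun i => v (e i)
    have : U * (A * diagonal d * Bᵀ) * Vᵀ = (U * A) * diagonal d * (V * B)ᵀ := by
      simp only [transpose_mul, Matrix.mul_assoc]
    rw [this]
    ext a b
    rw [Matrix.mul_apply]
    simp only [mul_diagonal, transpose_apply]
    rw [diagonal_apply, Finset.sum_eq_single (e a)]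
    · rw [hUA _ _ (Or.inr (heS a)), hVB _ _ (heZ a)]
      by_cases hab : a = b
      · simp [hab]
      · simp [hab, he.eq_iff, Ne.symm hab]
    · intro r _ hr
      by_cases hrZ : r ∈ Z
      · rw [hVB _ _ hrZ]
        by_cases hbr : e b = r
        · rw [hUA _ _ (Or.inr (hbr ▸ heS b))]; simp [Ne.symm hr]
        · simp [hbr]
      · rw [hUA _ _ (Or.inl hrZ)]; simp [Ne.symm hr]
    · simp
  · rw [hUA _ _ (Or.inr (heS i))]; simp [he.eq_iff]
  · rw [hVB _ _ (heZ i)]; simp [he.eq_iff]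

theorem exists_injective_fin_of_card_le {R m : ℕ} (s : Finset (Fin R)) (hs : m ≤ s.card) :
    ∃ e : Fin m → Fin R, Function.Injective e ∧ ∀ i, e i ∈ s := by
  obtain ⟨t, hts, ht⟩ := Finset.exists_subset_card_eq hs
  exact ⟨fun i => t.orderEmbOfFin ht i, (t.orderEmbOfFin ht).injective,
    fun i => hts (t.orderEmbOfFin_mem ht i)⟩

/-- The number of nonzero entries. -/
noncomputable def weight {R : ℕ} (d : Fin R → ℝ) : ℕ := (Finset.univ.filter fun r => d r ≠ 0).card

theorem weighted_rank_le {I J R : ℕ} (A : Matrix (Fin I) (Fin R) ℝ)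
    (B : Matrix (Fin J) (Fin R) ℝ) (d : Fin R → ℝ) : (weighted A B d).rank ≤ weight d := by
  rw [weighted_eq]
  refine (rank_mul_le_left _ _).trans ((rank_mul_le_right _ _).trans ?_)
  rw [rank_diagonal, weight, Fintype.card_subtype]

/-- Take the m indices inside the support of d if it is large enough, and around it otherwise.
Compression by U and V leaves a diagonal matrix with at least min(weight d, m) nonzero entries. -/
theorem Separates.min_weight_le_rank {I J R m : ℕ} {A : Matrix (Fin I) (Fin R) ℝ}
    {B : Matrix (Fin J) (Fin R) ℝ} (h : Separates m A B) (hm : m ≤ R) (d : Fin R → ℝ) :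
    min (weight d) m ≤ (weighted A B d).rank := by
  classical
  set s := Finset.univ.filter fun r => d r ≠ 0 with hs
  have key : ∃ e : Fin m → Fin R, Function.Injective e ∧
      min (weight d) m ≤ (Finset.univ.filter fun i => d (e i) ≠ 0).card := by
    by_cases hc : m ≤ s.card
    · obtain ⟨e, he, hes⟩ := exists_injective_fin_of_card_le s hc
      refine ⟨e, he, ?_⟩
      have : (Finset.univ.filter fun i => d (e i) ≠ 0) = Finset.univ := by
        ext i; simpa [hs] using hes i
      rw [this]; simp
    · obtain ⟨t, hst, ht⟩ := Finset.exists_superset_card_eq (s := s) (n := m) (by omega) (by simpa using hm)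
      refine ⟨fun i => t.orderEmbOfFin ht i, (t.orderEmbOfFin ht).injective, ?_⟩
      refine (min_le_left _ _).trans ?_
      have : s ⊆ (Finset.univ.filter fun i => d (t.orderEmbOfFin ht i) ≠ 0).image
          (fun i => t.orderEmbOfFin ht i) := by
        intro r hr
        have hrt : r ∈ Set.range (t.orderEmbOfFin ht) := by
          rw [Finset.range_orderEmbOfFin]; exact hst hr
        obtain ⟨i, rfl⟩ := hrt
        refine Finset.mem_image_of_mem _ ?_
        simpa [hs] using hr
      exact (Finset.card_le_card this).trans Finset.card_image_le
  obtain ⟨e, he, hle⟩ := key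
  obtain ⟨U, V, h1, -, -⟩ := h e he
  have h3 := rank_mul_le_left (U * weighted A B d) Vᵀ
  have h4 := rank_mul_le_right U (weighted A B d)
  rw [h1, rank_diagonal, Fintype.card_subtype] at h3
  omega

theorem weight_eq_zero {R : ℕ} {d : Fin R → ℝ} (h : weight d = 0) : d = 0 := by
  ext r
  rw [weight, Finset.card_eq_zero] at h
  by_contra hr
  have : r ∈ Finset.univ.filter fun r => d r ≠ 0 := by simpa using hr
  rw [h] at this
  simp at this

/-- This is the linear independence of the matrices a_r b_rᵀ. -/
theorem Separates.eq_zero {I J R m : ℕ} {A : Matrix (Fin I) (Fin R) ℝ}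
    {B : Matrix (Fin J) (Fin R) ℝ} (h : Separates m A B) (hm : m ≤ R) (hm0 : 0 < m)
    (d : Fin R → ℝ) (hd : weighted A B d = 0) : d = 0 := by
  have := h.min_weight_le_rank hm d
  rw [hd, rank_zero] at this
  exact weight_eq_zero (by omega)

/-! ### Computable formulas and exhaustive search programs -/

theorem State.store_same (σ : State) (m n k : ℕ) (M : Matrix (Fin m) (Fin n) ℝ) :
    σ.store m n k M m n k = M := by
  simp [State.store]

theorem State.store_of_ne (σ : State) (m n k : ℕ) (M : Matrix (Fin m) (Fin n) ℝ) (m' n' k' : ℕ)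
    (h : k' ≠ k) : σ.store m n k M m' n' k' = σ m' n' k' := by
  unfold State.store
  by_cases hm : m' = m
  · subst hm
    by_cases hn : n' = n
    · subst hn
      simp [Function.update_of_ne h]
    · simp [Function.update_of_ne hn]
  · simp [Function.update_of_ne hm]

/-- The tensor with a given unfolding. -/
def fold {I J K : ℕ} (M : Matrix (Fin (I * J)) (Fin K) ℝ) : Tensor I J K :=
  fun i j k => M (finProdFinEquiv (i, j)) k

theorem fold_unfolding {I J K : ℕ} (T : Tensor I J K) : fold (unfolding T) = T := by
  ext i j k
  simp only [fold, unfolding, of_apply, Equiv.symm_apply_apply]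

/-- Real-valued functions of a tensor (in register `0`) and a square matrix (in register `4`) that
are computed by some expression. -/
def Comp {I J K n : ℕ} (f : Tensor I J K → Matrix (Fin n) (Fin n) ℝ → ℝ) : Prop :=
  ∃ e : MatExpr 1 1, ∀ σ : State, e.eval σ 0 0 = f (fold (σ (I * J) K 0)) (σ n n 4)

section
variable {I J K n : ℕ}

theorem Comp.ratCast (q : ℚ) :
    Comp (fun (_ : Tensor I J K) (_ : Matrix (Fin n) (Fin n) ℝ) => (q : ℝ)) :=
  ⟨.const (Matrix.of fun _ _ => q), fun σ => by simp [MatExpr.eval]⟩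

theorem Comp.zero : Comp (fun (_ : Tensor I J K) (_ : Matrix (Fin n) (Fin n) ℝ) => (0 : ℝ)) := by
  simpa using Comp.ratCast (I := I) (J := J) (K := K) (n := n) 0

theorem Comp.one : Comp (fun (_ : Tensor I J K) (_ : Matrix (Fin n) (Fin n) ℝ) => (1 : ℝ)) := by
  simpa using Comp.ratCast (I := I) (J := J) (K := K) (n := n) 1

theorem Comp.tensor (i : Fin I) (j : Fin J) (k : Fin K) :
    Comp (fun (T : Tensor I J K) (_ : Matrix (Fin n) (Fin n) ℝ) => T i j k) :=
  ⟨.rearrange (fun _ _ => (finProdFinEquiv (i, j), k)) (.reg _ _ 0), fun σ => by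
    simp [MatExpr.eval, fold]⟩

theorem Comp.matrix (i j : Fin n) :
    Comp (fun (_ : Tensor I J K) (V : Matrix (Fin n) (Fin n) ℝ) => V i j) :=
  ⟨.rearrange (fun _ _ => (i, j)) (.reg _ _ 4), fun σ => by simp [MatExpr.eval]⟩

variable {f g : Tensor I J K → Matrix (Fin n) (Fin n) ℝ → ℝ}

theorem Comp.add (hf : Comp f) (hg : Comp g) : Comp (fun T V => f T V + g T V) := by
  obtain ⟨e, he⟩ := hf
  obtain ⟨e', he'⟩ := hg
  exact ⟨.add e e', fun σ => by simp [MatExpr.eval, he, he']⟩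

theorem Comp.mul (hf : Comp f) (hg : Comp g) : Comp (fun T V => f T V * g T V) := by
  obtain ⟨e, he⟩ := hf
  obtain ⟨e', he'⟩ := hg
  exact ⟨.mul e e', fun σ => by simp [MatExpr.eval, Matrix.mul_apply, he, he']⟩

theorem Comp.inv (hf : Comp f) : Comp (fun T V => (f T V)⁻¹) := by
  obtain ⟨e, he⟩ := hf
  refine ⟨.inv e, fun σ => ?_⟩
  change (e.eval σ)⁻¹ 0 0 = (f _ _)⁻¹
  rw [← he σ, Matrix.inv_def, det_fin_one]
  simp

theorem Comp.sum {ι : Type*} (s : Finset ι) {f : ι → Tensor I J K → Matrix (Fin n) (Fin n) ℝ → ℝ}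
    (h : ∀ i, Comp (f i)) : Comp (fun T V => ∑ i ∈ s, f i T V) := by
  classical
  induction s using Finset.induction_on with
  | empty => simpa using Comp.zero
  | insert a s ha ih => simpa [Finset.sum_insert ha] using (h a).add ih

theorem Comp.prod {ι : Type*} (s : Finset ι) {f : ι → Tensor I J K → Matrix (Fin n) (Fin n) ℝ → ℝ}
    (h : ∀ i, Comp (f i)) : Comp (fun T V => ∏ i ∈ s, f i T V) := by
  classical
  induction s using Finset.induction_on with
  | empty => simpa using Comp.one
  | insert a s ha ih => simpa [Finset.prod_insert ha] using (h a).mul ih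

theorem Comp.det {ι : Type*} [Fintype ι] [DecidableEq ι]
    {M : Tensor I J K → Matrix (Fin n) (Fin n) ℝ → Matrix ι ι ℝ}
    (h : ∀ i j, Comp (fun T V => M T V i j)) : Comp (fun T V => (M T V).det) := by
  simp only [det_apply']
  refine Comp.sum _ fun σ => Comp.mul ?_ (Comp.prod _ fun i => h _ _)
  simpa using Comp.ratCast (I := I) (J := J) (K := K) (n := n) ((Equiv.Perm.sign σ : ℤ) : ℚ)

theorem Comp.cramer {ι : Type*} [Fintype ι] [DecidableEq ι]
    {M : Tensor I J K → Matrix (Fin n) (Fin n) ℝ → Matrix ι ι ℝ}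
    {v : Tensor I J K → Matrix (Fin n) (Fin n) ℝ → ι → ℝ}
    (h : ∀ i j, Comp (fun T V => M T V i j)) (hv : ∀ i, Comp (fun T V => v T V i)) (i : ι) :
    Comp (fun T V => (M T V).cramer (v T V) i) := by
  simp only [cramer_apply]
  refine Comp.det fun a b => ?_
  by_cases hb : b = i
  · simpa [updateCol_apply, hb] using hv a
  · simpa [updateCol_apply, hb] using h a b

/-- The adjugate formula needs no case distinction: for a singular matrix both sides are zero,
because the real inverse of 0 is 0. -/
theorem Comp.matInv {ι : Type*} [Fintype ι] [DecidableEq ι]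
    {M : Tensor I J K → Matrix (Fin n) (Fin n) ℝ → Matrix ι ι ℝ}
    (h : ∀ i j, Comp (fun T V => M T V i j)) (i j : ι) : Comp (fun T V => (M T V)⁻¹ i j) := by
  have : ∀ T V, (M T V)⁻¹ i j = (M T V).det⁻¹ * (M T V).adjugate i j := by
    intro T V
    rw [Matrix.inv_def, Ring.inverse_eq_inv']; rfl
  simp only [this, adjugate_def, of_apply]
  refine (Comp.det h).inv.mul (Comp.cramer (fun a b => h b a) (fun a => ?_) j)
  by_cases ha : a = i
  · subst ha; simpa using Comp.one
  · simpa [Pi.single_apply, ha] using Comp.zero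

theorem exists_sum_expr {m p : ℕ} {ι : Type*} (s : Finset ι) (E : ι → MatExpr m p) :
    ∃ e : MatExpr m p, ∀ σ, e.eval σ = ∑ i ∈ s, (E i).eval σ := by
  classical
  induction s using Finset.induction_on with
  | empty => exact ⟨.const 0, fun σ => by ext; simp [MatExpr.eval]⟩
  | insert a s ha ih =>
    obtain ⟨e, he⟩ := ih
    exact ⟨.add (E a) e, fun σ => by simp [MatExpr.eval, he, Finset.sum_insert ha]⟩

/-- A matrix is the sum of its entries times elementary matrices, each of which is a rational column
times a rational row. -/
theorem exists_expr_of_comp {m p : ℕ}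
    {F : Tensor I J K → Matrix (Fin n) (Fin n) ℝ → Matrix (Fin m) (Fin p) ℝ}
    (h : ∀ i j, Comp (fun T V => F T V i j)) :
    ∃ e : MatExpr m p, ∀ σ : State, e.eval σ = F (fold (σ (I * J) K 0)) (σ n n 4) := by
  choose E hE using h
  obtain ⟨e, he⟩ := exists_sum_expr Finset.univ (fun ij : Fin m × Fin p =>
    MatExpr.mul (.const (Matrix.of fun a (_ : Fin 1) => if a = ij.1 then (1 : ℚ) else 0))
      (.mul (E ij.1 ij.2) (.const (Matrix.of fun (_ : Fin 1) b => if b = ij.2 then (1 : ℚ) else 0))))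
  refine ⟨e, fun σ => ?_⟩
  rw [he]
  ext a b
  rw [Matrix.sum_apply]
  simp only [MatExpr.eval, Matrix.mul_apply, Finset.univ_unique, Finset.sum_singleton,
    Fin.default_eq_zero, Fin.isValue, hE, map_apply, of_apply]
  rw [Finset.sum_eq_single (a, b)]
  · simp
  · rintro ⟨i, j⟩ - hij
    by_cases ha : a = i
    · subst ha
      have : b ≠ j := fun hb => hij (by rw [hb])
      simp [this]
    · simp [ha]
  · simp

end

/-- One GEVD followed by finitely many candidate formulas for the factor matrices. -/
structure Stage (I J K R : ℕ) where
  n : ℕ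
  P : Tensor I J K → Matrix (Fin n) (Fin n) ℝ
  Q : Tensor I J K → Matrix (Fin n) (Fin n) ℝ
  ι : Type
  fin : Finite ι
  A : ι → Tensor I J K → Matrix (Fin n) (Fin n) ℝ → Matrix (Fin I) (Fin R) ℝ
  B : ι → Tensor I J K → Matrix (Fin n) (Fin n) ℝ → Matrix (Fin J) (Fin R) ℝ
  C : ι → Tensor I J K → Matrix (Fin n) (Fin n) ℝ → Matrix (Fin K) (Fin R) ℝ
  compP : ∀ i j, Comp (fun T (_ : Matrix (Fin n) (Fin n) ℝ) => P T i j)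
  compQ : ∀ i j, Comp (fun T (_ : Matrix (Fin n) (Fin n) ℝ) => Q T i j)
  compA : ∀ g i j, Comp (fun T V => A g T V i j)
  compB : ∀ g i j, Comp (fun T V => B g T V i j)
  compC : ∀ g i j, Comp (fun T V => C g T V i j)

/-- Every GEVD of the pencil leads to a polyadic decomposition by one of the formulas. -/
def Stage.Solves {I J K R : ℕ} (S : Stage I J K R) (T : Tensor I J K) : Prop :=
  (∃ V α β, IsGEVD (S.P T) (S.Q T) V α β) ∧
    ∀ V α β, IsGEVD (S.P T) (S.Q T) V α β →
      ∃ g, polyadic (S.A g T V) (S.B g T V) (S.C g T V) = T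

theorem rank_eq_zero_iff {m n : ℕ} (M : Matrix (Fin m) (Fin n) ℝ) : M.rank = 0 ↔ M = 0 := by
  refine ⟨fun h => ?_, fun h => by rw [h, rank_zero]⟩
  rw [Matrix.rank, Submodule.finrank_eq_zero, LinearMap.range_eq_bot] at h
  ext i j
  have := congrFun (LinearMap.congr_fun h (Pi.single j 1)) i
  simpa using this

theorem Program.exists_exec (p : Program) : ∀ σ, ∃ τ, p.Exec σ τ := by
  induction p with
  | skip => exact fun σ => ⟨σ, rfl⟩
  | assign k e => exact fun σ => ⟨_, rfl⟩
  | @orthCompl m n d k e =>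
    intro σ
    by_cases h : ∃ N' : Matrix (Fin m) (Fin d) ℝ, IsOrthComplBasis (e.eval σ) N'
    · exact ⟨_, h.choose, fun _ => h.choose_spec, rfl⟩
    · exact ⟨_, 0, fun h' => absurd h' h, rfl⟩
  | @gevd n v a b e f =>
    intro σ
    by_cases h : ∃ (V' : Matrix (Fin n) (Fin n) ℝ) (α' β' : Fin n → ℝ),
            IsGEVD (e.eval σ) (f.eval σ) V' α' β'
    · obtain ⟨V, α, β, h'⟩ := h
      exact ⟨_, V, α, β, fun _ => h', rfl⟩
    · exact ⟨_, 0, 0, 0, fun h' => absurd h' h, rfl⟩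
  | ifRank e r p q ihp ihq =>
    intro σ
    by_cases h : (e.eval σ).rank = r
    · obtain ⟨τ, hτ⟩ := ihp σ
      exact ⟨τ, Or.inl ⟨h, hτ⟩⟩
    · obtain ⟨τ, hτ⟩ := ihq σ
      exact ⟨τ, Or.inr ⟨h, hτ⟩⟩
  | seq p q ihp ihq =>
    intro σ
    obtain ⟨ρ, hρ⟩ := ihp σ
    obtain ⟨τ, hτ⟩ := ihq ρ
    exact ⟨τ, ρ, hρ, hτ⟩

/-- A candidate is right exactly when the residual T − [A, B, C] has rank 0, which a program can
test without knowing the true factors. A rejected candidate writes nothing, so the next test and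
finally `next` start from the same state. -/
theorem Stage.exists_check_program {I J K R : ℕ} (S : Stage I J K R) (L : List S.ι)
    (next : Program) :
    ∃ p : Program, ∀ σ τ, p.Exec σ τ →
      polyadic (τ I R 1) (τ J R 2) (τ K R 3) = fold (σ (I * J) K 0) ∨
      ((∀ g ∈ L, polyadic (S.A g (fold (σ (I * J) K 0)) (σ S.n S.n 4))
        (S.B g (fold (σ (I * J) K 0)) (σ S.n S.n 4))
        (S.C g (fold (σ (I * J) K 0)) (σ S.n S.n 4)) ≠ fold (σ (I * J) K 0)) ∧
        next.Exec σ τ) := by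
  induction L with
  | nil => exact ⟨next, fun σ τ h => Or.inr ⟨by simp, h⟩⟩
  | cons g L ih =>
    obtain ⟨p, hp⟩ := ih
    obtain ⟨eA, hA⟩ := exists_expr_of_comp (S.compA g)
    obtain ⟨eB, hB⟩ := exists_expr_of_comp (S.compB g)
    obtain ⟨eC, hC⟩ := exists_expr_of_comp (S.compC g)
    have hE : ∀ x k, Comp (fun T V => (unfolding T x k : ℝ) +
        ((-1 : ℚ) : ℝ) * unfolding (polyadic (S.A g T V) (S.B g T V) (S.C g T V)) x k) := by
      intro x k
      refine (Comp.tensor _ _ _).add ((Comp.ratCast _).mul ?_)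
      simp only [unfolding, of_apply, polyadic]
      exact Comp.sum Finset.univ fun r =>
        ((S.compA g _ r).mul (S.compB g _ r)).mul (S.compC g _ r)
    obtain ⟨e, he⟩ := exists_expr_of_comp (F := fun T V => Matrix.of fun x k =>
      (unfolding T x k : ℝ) +
        ((-1 : ℚ) : ℝ) * unfolding (polyadic (S.A g T V) (S.B g T V) (S.C g T V)) x k) hE
    refine ⟨.ifRank e 0 (.seq (.assign 1 eA) (.seq (.assign 2 eB) (.assign 3 eC))) p, ?_⟩
    intro σ τ h
    set T := fold (σ (I * J) K 0) with hT
    set V := σ S.n S.n 4 with hV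
    have hrank : (e.eval σ).rank = 0 ↔
        polyadic (S.A g T V) (S.B g T V) (S.C g T V) = T := by
      rw [rank_eq_zero_iff, he, ← hT, ← hV]
      constructor
      · intro h0
        have hu : unfolding (polyadic (S.A g T V) (S.B g T V) (S.C g T V)) = unfolding T := by
          ext x k
          have := congrFun (congrFun h0 x) k
          simp only [of_apply, Rat.cast_neg, Rat.cast_one, Matrix.zero_apply] at this
          linarith
        have := congrArg fold hu
        rwa [fold_unfolding, fold_unfolding] at this
      · intro h0
        ext x k
        simp only [of_apply, Rat.cast_neg, Rat.cast_one, Matrix.zero_apply, h0]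
        ring
    rcases h with ⟨h0, h1⟩ | ⟨h0, h1⟩
    · left
      rw [hrank] at h0
      obtain ⟨ρ₁, h1, ρ₂, h2, h3⟩ := h1
      simp only [Program.Exec] at h1 h2 h3
      rw [hA, ← hT, ← hV] at h1
      have hB' : eB.eval ρ₁ = S.B g T V := by
        rw [hB, h1, State.store_of_ne _ _ _ _ _ _ _ _ (by decide),
          State.store_of_ne _ _ _ _ _ _ _ _ (by decide)]
      rw [hB'] at h2
      have hC' : eC.eval ρ₂ = S.C g T V := by
        rw [hC, h2, h1, State.store_of_ne _ _ _ _ _ _ _ _ (by decide),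
          State.store_of_ne _ _ _ _ _ _ _ _ (by decide),
          State.store_of_ne _ _ _ _ _ _ _ _ (by decide),
          State.store_of_ne _ _ _ _ _ _ _ _ (by decide)]
      rw [hC'] at h3
      have e1 : τ I R 1 = S.A g T V := by
        rw [h3, State.store_of_ne _ _ _ _ _ _ _ _ (by decide), h2,
          State.store_of_ne _ _ _ _ _ _ _ _ (by decide), h1, State.store_same]
      have e2 : τ J R 2 = S.B g T V := by
        rw [h3, State.store_of_ne _ _ _ _ _ _ _ _ (by decide), h2, State.store_same]
      have e3 : τ K R 3 = S.C g T V := by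
        rw [h3, State.store_same]
      rw [e1, e2, e3, h0]
    · rw [Ne, hrank] at h0
      rcases hp σ τ h1 with h2 | ⟨h2, h3⟩
      · exact Or.inl h2
      · refine Or.inr ⟨fun g' hg' => ?_, h3⟩
        rcases List.mem_cons.1 hg' with rfl | hg'
        · exact h0
        · exact h2 g' hg'

/-- A stage that does not solve T may receive an arbitrary result from its GEVD, but it can end the
search only with an exact decomposition. A stage that solves T always ends it. -/
theorem exists_program_of_stage_list {I J K R : ℕ} (L : List (Stage I J K R)) :
    ∃ p : Program, ∀ σ τ, (∃ S ∈ L, S.Solves (fold (σ (I * J) K 0))) → p.Exec σ τ →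
      polyadic (τ I R 1) (τ J R 2) (τ K R 3) = fold (σ (I * J) K 0) := by
  induction L with
  | nil => exact ⟨.skip, by simp⟩
  | cons S L ih =>
    obtain ⟨p, hp⟩ := ih
    obtain ⟨eP, hP⟩ := exists_expr_of_comp S.compP
    obtain ⟨eQ, hQ⟩ := exists_expr_of_comp S.compQ
    have := S.fin
    have := Fintype.ofFinite S.ι
    obtain ⟨c, hc⟩ := S.exists_check_program Finset.univ.toList p
    -- Registers 4, 5, 6 differ in name from the input register 0, so the tensor survives whatever
    -- the matrix formats are.
    refine ⟨.seq (.gevd 4 5 6 eP eQ) c, ?_⟩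
    rintro σ τ hS ⟨ρ, ⟨V, α, β, h1, hρ⟩, h2⟩
    have hρ0 : ρ (I * J) K 0 = σ (I * J) K 0 := by
      rw [hρ, State.store_of_ne _ _ _ _ _ _ _ _ (by decide),
        State.store_of_ne _ _ _ _ _ _ _ _ (by decide),
        State.store_of_ne _ _ _ _ _ _ _ _ (by decide)]
    have hρV : ρ S.n S.n 4 = V := by
      rw [hρ, State.store_of_ne _ _ _ _ _ _ _ _ (by decide),
        State.store_of_ne _ _ _ _ _ _ _ _ (by decide), State.store_same]
    have h3 := hc ρ τ h2
    rw [hρ0, hρV] at h3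
    rw [hP, hQ] at h1
    rcases h3 with h3 | ⟨h3, h4⟩
    · exact h3
    · obtain ⟨S', hS', hsol⟩ := hS
      rcases List.mem_cons.1 hS' with rfl | hS'
      · obtain ⟨g, hg⟩ := hsol.2 V α β (h1 hsol.1)
        exact absurd hg (h3 g (by simp))
      · rw [← hρ0]
        exact hp ρ τ ⟨S', hS', by rwa [hρ0]⟩ h4

/-- If every tensor in a class is solved by one of finitely many stages, there is one program
that decomposes all of them. -/
theorem cpdFoundAlgebraically_of_stages {I J K R : ℕ} {G : Type*} [Finite G]
    (stage : G → Stage I J K R) (𝒯 : Set (Tensor I J K)) (hrank : ∀ T ∈ 𝒯, tensorRank T = R)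
    (hsol : ∀ T ∈ 𝒯, ∃ g, (stage g).Solves T) : CPDFoundAlgebraically R 𝒯 := by
  have := Fintype.ofFinite G
  obtain ⟨p, hp⟩ := exists_program_of_stage_list (Finset.univ.toList.map stage)
  refine ⟨p, fun T hT => ⟨p.exists_exec _, fun τ hτ => ?_⟩⟩
  have h0 : fold ((initialState T) (I * J) K 0) = T := by
    rw [initialState, State.store_same, fold_unfolding]
  have := hp _ τ (by
    rw [h0]
    obtain ⟨g, hg⟩ := hsol T hT
    exact ⟨stage g, by simp, hg⟩) hτ
  rw [h0] at this
  exact ⟨this.symm, (hrank T hT).symm⟩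

/-! ### Projection of the third factor into general position -/

/-- The point `(1, t, t², …)` of the moment curve. -/
def moment (n t : ℕ) : Fin n → ℝ := fun j => (t : ℝ) ^ (j : ℕ)

/-- Each z i gives a nonzero polynomial in t of degree at most n, so their product has at most |ι|·n
roots. The bound does not depend on z: a list of rational vectors fixed in advance contains one that
avoids the given hyperplanes. -/
theorem exists_moment_ne_zero {ι : Type*} [Fintype ι] {n N : ℕ} (z : ι → Fin n → ℝ)
    (hz : ∀ i, z i ≠ 0) (hN : Fintype.card ι * n < N) :
    ∃ t : Fin N, ∀ i, moment n t ⬝ᵥ z i ≠ 0 := by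
  classical
  let f : ι → Polynomial ℝ := fun i => ∑ j : Fin n, Polynomial.monomial (j : ℕ) (z i j)
  have hf : ∀ i, f i ≠ 0 := by
    intro i h0
    apply hz i
    ext j
    have := congrArg (fun p => Polynomial.coeff p j) h0
    simpa [f, Polynomial.finsetSum_coeff, Polynomial.coeff_monomial, Fin.val_inj] using this
  have hdeg : ∀ i, (f i).natDegree ≤ n := fun i =>
    Polynomial.natDegree_sum_le_of_forall_le _ _ fun j _ =>
      (Polynomial.natDegree_monomial_le _).trans j.2.le
  have heval : ∀ i (t : ℕ), (f i).eval (t : ℝ) = moment n t ⬝ᵥ z i := by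
    intro i t
    simp only [f, Polynomial.eval_finsetSum, Polynomial.eval_monomial, dotProduct, moment]
    exact Finset.sum_congr rfl fun j _ => mul_comm _ _
  by_contra hcon
  push Not at hcon
  have : ∏ i, f i = 0 := by
    refine Polynomial.eq_zero_of_natDegree_lt_card_of_eval_eq_zero (f := fun t : Fin N => ((t : ℕ) : ℝ))
      _ (fun a b hab => ?_) (fun t => ?_) ?_
    · simpa [Fin.val_inj] using hab
    · obtain ⟨i, hi⟩ := hcon t
      rw [Polynomial.eval_prod]
      exact Finset.prod_eq_zero (Finset.mem_univ i) (by rw [heval, hi])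
    · rw [Fintype.card_fin]
      refine lt_of_le_of_lt (Polynomial.natDegree_prod_le _ _) (lt_of_le_of_lt ?_ hN)
      calc ∑ i, (f i).natDegree ≤ ∑ _i : ι, n := Finset.sum_le_sum fun i _ => hdeg i
        _ = Fintype.card ι * n := by simp
  exact absurd (Finset.prod_eq_zero_iff.1 this) (by simpa using hf)

/-- Any `k` columns of the `k`-rowed matrix `C` span the whole space. -/
def GenPos {k R : ℕ} (C : Matrix (Fin k) (Fin R) ℝ) : Prop :=
  ∀ S : Finset (Fin R), S.card = k → ∀ x : Fin k → ℝ, (∀ r ∈ S, x ⬝ᵥ C.col r = 0) → x = 0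

/-- The matrix with rows on the moment curve. -/
def momentMatrix {k : ℕ} (K : ℕ) {N : ℕ} (t : Fin k → Fin N) : Matrix (Fin k) (Fin K) ℝ :=
  Matrix.of fun i => moment K (t i)

/-- The rows are found one at a time. If i < k rows are present, every k-set S carries a nontrivial
relation w_S among the columns of the product. Since the columns of C in S are independent, C w_S ≠
0, and the new row is chosen to be nonzero on all C w_S. Pairing a vanishing combination of rows
with w_S then kills the coefficient of the new row. -/
theorem exists_momentMatrix_genPos {K R k N : ℕ} (C : Matrix (Fin K) (Fin R) ℝ)
    (hC : k ≤ kRank C) (hN : Fintype.card {S : Finset (Fin R) // S.card = k} * K < N) :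
    ∃ t : Fin k → Fin N, GenPos (momentMatrix K t * C) := by
  classical
  suffices h : ∀ i ≤ k, ∃ t : Fin i → Fin N, ∀ S : Finset (Fin R), S.card = k →
      ∀ x : Fin i → ℝ, (∀ r ∈ S, x ⬝ᵥ (momentMatrix K t * C).col r = 0) → x = 0 from h k le_rfl
  intro i
  induction i with
  | zero => exact fun _ => ⟨Fin.elim0, fun S _ x _ => Subsingleton.elim _ _⟩
  | succ i ih =>
    intro hi
    obtain ⟨t, ht⟩ := ih (by omega)
    have hw : ∀ S : {S : Finset (Fin R) // S.card = k}, ∃ w : S.1 → ℝ, w ≠ 0 ∧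
        ∀ a, ∑ r : S.1, (momentMatrix K t * C) a r * w r = 0 := by
      intro S
      obtain ⟨w, hw, h⟩ := exists_ne_zero_dotProduct_eq_zero
        (fun a (r : S.1) => (momentMatrix K t * C) a r) Finset.univ (by simp [S.2]; omega)
      exact ⟨w, hw, fun a => h a (Finset.mem_univ _)⟩
    choose w hw0 hw using hw
    obtain ⟨t', ht'⟩ := exists_moment_ne_zero (fun S => ∑ r, w S r • C.col r) (by
      intro S h0
      have hind : LinearIndependent ℝ (fun r : S.1 => C.col r) :=
        linearIndepOn_of_card_le_kRank C S.1 (by rw [S.2]; exact hC)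
      exact hw0 S (funext (Fintype.linearIndependent_iff.1 hind (w S) h0))) hN
    refine ⟨Fin.cons t' t, fun S hS x hx => ?_⟩
    have hx' : ∀ r ∈ S, x 0 * (moment K t' ⬝ᵥ C.col r) +
        (fun a : Fin i => x a.succ) ⬝ᵥ (momentMatrix K t * C).col r = 0 := by
      intro r hr
      have := hx r hr
      rw [dotProduct, Fin.sum_univ_succ] at this
      exact this
    have hx0 : x 0 = 0 := by
      have h1 : ∑ r : S, w ⟨S, hS⟩ r * (x 0 * (moment K t' ⬝ᵥ C.col r) +
        (fun a : Fin i => x a.succ) ⬝ᵥ (momentMatrix K t * C).col r) = 0 :=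
        Finset.sum_eq_zero fun r _ => by rw [hx' r r.2, mul_zero]
      simp only [mul_add, Finset.sum_add_distrib] at h1
      have h2 : ∑ r : S, w ⟨S, hS⟩ r * ((fun a : Fin i => x a.succ) ⬝ᵥ
          (momentMatrix K t * C).col r) = 0 := by
        simp only [dotProduct, Finset.mul_sum]
        rw [Finset.sum_comm]
        refine Finset.sum_eq_zero fun a _ => ?_
        have := hw ⟨S, hS⟩ a
        calc _ = x a.succ * ∑ r : S, (momentMatrix K t * C) a r * w ⟨S, hS⟩ r := by
              rw [Finset.mul_sum]
              exact Finset.sum_congr rfl fun r _ => by rw [col_apply]; ring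
          _ = 0 := by rw [this, mul_zero]
      have h3 : ∑ r : S, w ⟨S, hS⟩ r * (x 0 * (moment K t' ⬝ᵥ C.col r)) =
          x 0 * (moment K t' ⬝ᵥ ∑ r, w ⟨S, hS⟩ r • C.col r) := by
        rw [dotProduct_sum, Finset.mul_sum]
        exact Finset.sum_congr rfl fun r _ => by rw [dotProduct_smul, smul_eq_mul]; ring
      rw [h2, h3, add_zero] at h1
      exact (mul_eq_zero.1 h1).resolve_right (ht' ⟨S, hS⟩)
    have hrest := ht S hS (fun a : Fin i => x a.succ) (fun r hr => by
      have := hx' r hr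
      rwa [hx0, zero_mul, zero_add] at this)
    ext a
    refine Fin.cases hx0 (fun a => congrFun hrest a) a

/-! ### Kruskal's permutation lemma -/

section flats
variable {k R R' : ℕ}

open Classical in
/-- The number of vectors of a family lying in a subspace. -/
noncomputable def countIn (c : Fin R → Fin k → ℝ) (F : Submodule ℝ (Fin k → ℝ)) : ℕ :=
  (Finset.univ.filter fun r => c r ∈ F).card

theorem sup_span_singleton_eq {F G : Submodule ℝ (Fin k → ℝ)} {v : Fin k → ℝ} (hFG : F ≤ G)
    (hfin : Module.finrank ℝ G = Module.finrank ℝ F + 1) (hv : v ∈ G) (hvF : v ∉ F) :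
    F ⊔ Submodule.span ℝ {v} = G := by
  have hle : F ⊔ Submodule.span ℝ {v} ≤ G :=
    sup_le hFG (by rw [Submodule.span_le]; simpa using hv)
  apply Submodule.eq_of_le_of_finrank_le hle
  rw [hfin]
  apply Submodule.finrank_lt_finrank_of_lt
  refine lt_of_le_of_ne le_sup_left fun h => hvF ?_
  rw [h]
  exact Submodule.mem_sup_right (Submodule.mem_span_singleton_self v)

theorem finrank_sup_span_singleton {F : Submodule ℝ (Fin k → ℝ)} {v : Fin k → ℝ} (hvF : v ∉ F) :
    Module.finrank ℝ (F ⊔ Submodule.span ℝ {v} : Submodule ℝ (Fin k → ℝ)) =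
      Module.finrank ℝ F + 1 := by
  apply le_antisymm
  · refine (Submodule.finrank_add_le_finrank_add_finrank _ _).trans ?_
    gcongr
    exact (finrank_span_le_card _).trans (by simp)
  · apply Submodule.finrank_lt_finrank_of_lt
    refine lt_of_le_of_ne le_sup_left fun h => hvF ?_
    rw [h]
    exact Submodule.mem_sup_right (Submodule.mem_span_singleton_self v)

theorem weight_add_countIn (c : Fin R → Fin k → ℝ) (x : Fin k → ℝ)
    (F : Submodule ℝ (Fin k → ℝ)) (hF : ∀ v, v ∈ F ↔ x ⬝ᵥ v = 0) :
    weight (fun r => x ⬝ᵥ c r) + countIn c F = R := by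
  classical
  have h1 : weight (fun r => x ⬝ᵥ c r) = (Finset.univ.filter fun r => ¬ (x ⬝ᵥ c r = 0)).card := by
    rw [weight]
  have h2 : countIn c F = (Finset.univ.filter fun r => x ⬝ᵥ c r = 0).card := by
    rw [countIn]
    congr 1
    ext r
    simp [hF]
  rw [h1, h2, add_comm, Finset.card_filter_add_card_filter_not]
  simp

theorem exists_ne_zero_orthogonal (F : Submodule ℝ (Fin k → ℝ)) (hF : Module.finrank ℝ F < k) :
    ∃ x : Fin k → ℝ, x ≠ 0 ∧ ∀ v ∈ F, x ⬝ᵥ v = 0 := by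
  let b := Module.finBasis ℝ F
  obtain ⟨x, hx0, hx⟩ := exists_ne_zero_dotProduct_eq_zero (fun i => (b i : Fin k → ℝ))
    Finset.univ (by simpa using hF)
  refine ⟨x, hx0, fun v hv => ?_⟩
  have h1 : (⟨v, hv⟩ : F) ∈ Submodule.span ℝ (Set.range b) := by rw [b.span_eq]; trivial
  have h2 : Submodule.span ℝ (Set.range b) ≤
      LinearMap.ker ((dotProductBilin ℝ ℝ x : (Fin k → ℝ) →ₗ[ℝ] ℝ).comp F.subtype) := by
    rw [Submodule.span_le]
    rintro _ ⟨i, rfl⟩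
    change x ⬝ᵥ (b i : Fin k → ℝ) = 0
    rw [dotProduct_comm]
    exact hx i (Finset.mem_univ _)
  exact h2 h1

theorem span_range_eq_top (c : Fin R → Fin k → ℝ)
    (h : ∀ x : Fin k → ℝ, (∀ r, x ⬝ᵥ c r = 0) → x = 0) :
    Submodule.span ℝ (Set.range c) = ⊤ := by
  by_contra hne
  obtain ⟨x, hx0, hx⟩ := exists_ne_zero_orthogonal _
    (by simpa using Submodule.finrank_lt (s := Submodule.span ℝ (Set.range c)) hne)
  exact hx0 (h x fun r => hx _ (Submodule.subset_span ⟨r, rfl⟩))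

/-- Kruskal's counting argument: if the hyperplanes spanned by the family `c'` contain sufficiently
many of the vectors `c`, then so do all smaller subspaces spanned by vectors of `c'`. -/
theorem countIn_add_le (c : Fin R → Fin k → ℝ) (c' : Fin R' → Fin k → ℝ)
    (hspan : Submodule.span ℝ (Set.range c') = ⊤)
    (H : ∀ x : Fin k → ℝ, weight (fun r => x ⬝ᵥ c' r) + k ≤ R' + 1 →
      weight (fun r => x ⬝ᵥ c r) ≤ weight (fun r => x ⬝ᵥ c' r)) (d : ℕ) :
    ∀ F : Submodule ℝ (Fin k → ℝ), Module.finrank ℝ F + d + 1 = k →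
      F ≤ Submodule.span ℝ {v | v ∈ F ∧ v ∈ Set.range c'} →
      countIn c' F + R ≤ countIn c F + R' := by
  classical
  induction d with
  | zero =>
    intro F hfin hF
    obtain ⟨x, hx0, hx⟩ := exists_ne_zero_orthogonal F (by omega)
    let φ : (Fin k → ℝ) →ₗ[ℝ] ℝ := dotProductBilin ℝ ℝ x
    have hφ : ∀ v, φ v = x ⬝ᵥ v := fun v => rfl
    have hle : F ≤ LinearMap.ker φ := hx
    have hker : Module.finrank ℝ (LinearMap.ker φ) < k := by
      have hne : LinearMap.ker φ ≠ ⊤ := by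
        intro h
        apply hx0
        have h1 : x ∈ LinearMap.ker φ := by rw [h]; trivial
        rw [LinearMap.mem_ker, hφ] at h1
        exact dotProduct_self_eq_zero.1 h1
      have := Submodule.finrank_lt hne
      simpa using this
    have hFk : F = LinearMap.ker φ := Submodule.eq_of_le_of_finrank_le hle (by omega)
    have hmem : ∀ v, v ∈ F ↔ x ⬝ᵥ v = 0 := fun v => by rw [hFk, LinearMap.mem_ker, hφ]
    have h1 := weight_add_countIn c x F hmem
    have h2 := weight_add_countIn c' x F hmem
    -- A hyperplane spanned by vectors of c' contains at least k − 1 of them, which is the bound on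
    -- the weight required by `H`.
    have h3 : Module.finrank ℝ F ≤ countIn c' F := by
      have e1 : {v | v ∈ F ∧ v ∈ Set.range c'} =
          ((Finset.univ.filter fun r => c' r ∈ F).image c' : Finset (Fin k → ℝ)) := by
        ext v
        simp only [Set.mem_ofPred_eq, Set.mem_range, Finset.coe_image, Finset.coe_filter,
          Finset.mem_univ, true_and, Set.mem_image]
        constructor
        · rintro ⟨hv, r, rfl⟩; exact ⟨r, hv, rfl⟩
        · rintro ⟨r, hv, rfl⟩; exact ⟨hv, r, rfl⟩
      rw [e1] at hF
      calc Module.finrank ℝ F ≤ _ := Submodule.finrank_mono hF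
        _ ≤ _ := finrank_span_finset_le_card _
        _ ≤ _ := Finset.card_image_le
    have := H x (by omega)
    omega
  | succ d ih =>
    intro F hfin hF
    set s' := Finset.univ.filter fun r => c' r ∉ F with hs'
    set s := Finset.univ.filter fun r => c r ∉ F with hs
    -- The flats one dimension above F that are spanned with one more vector of c'. They partition
    -- the vectors of c' outside F and contain disjoint sets of vectors of c outside F.
    set 𝓕 := s'.image (fun r => F ⊔ Submodule.span ℝ {c' r}) with h𝓕
    have hprop : ∀ G ∈ 𝓕, F ≤ G ∧ Module.finrank ℝ G = Module.finrank ℝ F + 1 ∧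
        G ≤ Submodule.span ℝ {v | v ∈ G ∧ v ∈ Set.range c'} := by
      intro G hG
      obtain ⟨r, hr, rfl⟩ := Finset.mem_image.1 hG
      have hr' : c' r ∉ F := by simpa [hs'] using hr
      refine ⟨le_sup_left, finrank_sup_span_singleton hr', sup_le (hF.trans ?_) ?_⟩
      · exact Submodule.span_mono fun v hv => ⟨Submodule.mem_sup_left hv.1, hv.2⟩
      · exact Submodule.span_mono (by
          rintro _ rfl
          exact ⟨Submodule.mem_sup_right (Submodule.mem_span_singleton_self _), r, rfl⟩)
    have hcount : ∀ {n : ℕ} (f : Fin n → Fin k → ℝ), ∀ G ∈ 𝓕, countIn f G = countIn f F +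
        ((Finset.univ.filter fun r => f r ∉ F).filter
          fun r => F ⊔ Submodule.span ℝ {f r} = G).card := by
      intro n f G hG
      obtain ⟨h1, h2, -⟩ := hprop G hG
      rw [countIn, countIn, ← Finset.card_union_of_disjoint]
      · congr 1
        ext r
        simp only [Finset.mem_filter, Finset.mem_univ, true_and, Finset.mem_union]
        constructor
        · intro hr
          by_cases hrF : f r ∈ F
          · exact Or.inl hrF
          · exact Or.inr ⟨hrF, sup_span_singleton_eq h1 h2 hr hrF⟩
        · rintro (hr | ⟨-, hr⟩)
          · exact h1 hr
          · rw [← hr]; exact Submodule.mem_sup_right (Submodule.mem_span_singleton_self _)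
      · rw [Finset.disjoint_left]
        intro r hr hr'
        simp only [Finset.mem_filter, Finset.mem_univ, true_and] at hr hr'
        exact hr'.1 hr
    have hsum' : s'.card = ∑ G ∈ 𝓕, (s'.filter fun r => F ⊔ Submodule.span ℝ {c' r} = G).card :=
      Finset.card_eq_sum_card_image _ _
    have hsum : ∑ G ∈ 𝓕, (s.filter fun r => F ⊔ Submodule.span ℝ {c r} = G).card ≤ s.card := by
      rw [← Finset.card_biUnion]
      · exact Finset.card_le_card (Finset.biUnion_subset.2 fun G _ => Finset.filter_subset _ _)
      · intro G _ G' _ hGG'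
        refine Finset.disjoint_left.2 fun r hr hr' => ?_
        simp only [Finset.mem_filter] at hr hr'
        exact hGG' (hr.2.symm.trans hr'.2)
    have hcs' : countIn c' F + s'.card = R' := by
      rw [countIn, hs', Finset.card_filter_add_card_filter_not]; simp
    have hcs : countIn c F + s.card = R := by
      rw [countIn, hs, Finset.card_filter_add_card_filter_not]; simp
    -- A single flat would contain all of c', but its dimension dim F + 1 is still less than k.
    have hcard : 2 ≤ 𝓕.card := by
      by_contra hlt
      have hFtop : F ≠ ⊤ := by
        rintro rfl
        rw [finrank_top] at hfin
        simp at hfin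
        omega
      have hex : ∃ r, c' r ∉ F := by
        by_contra hcon
        push Not at hcon
        apply hFtop
        rw [eq_top_iff, ← hspan, Submodule.span_le]
        rintro _ ⟨r, rfl⟩
        exact hcon r
      obtain ⟨r, hr⟩ := hex
      have hG : F ⊔ Submodule.span ℝ {c' r} ∈ 𝓕 := Finset.mem_image_of_mem _ (by simpa [hs'] using hr)
      have hall : Submodule.span ℝ (Set.range c') ≤ F ⊔ Submodule.span ℝ {c' r} := by
        rw [Submodule.span_le]
        rintro _ ⟨r', rfl⟩
        by_cases hr' : c' r' ∈ F
        · exact Submodule.mem_sup_left hr'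
        · have hG' : F ⊔ Submodule.span ℝ {c' r'} ∈ 𝓕 :=
            Finset.mem_image_of_mem _ (by simpa [hs'] using hr')
          have := Finset.card_le_one.1 (by omega) _ hG _ hG'
          rw [this]
          exact Submodule.mem_sup_right (Submodule.mem_span_singleton_self _)
      rw [hspan, top_le_iff] at hall
      have h1 := (hprop _ hG).2.1
      rw [hall, finrank_top] at h1
      simp at h1
      omega
    have hIH : ∀ G ∈ 𝓕, (countIn c' F + R : ℤ) +
        ((s'.filter fun r => F ⊔ Submodule.span ℝ {c' r} = G).card : ℤ) ≤ (countIn c F + R' : ℤ) +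
        ((s.filter fun r => F ⊔ Submodule.span ℝ {c r} = G).card : ℤ) := by
      intro G hG
      obtain ⟨-, h2, h3⟩ := hprop G hG
      have := ih G (by omega) h3
      rw [hcount c' G hG, hcount c G hG] at this
      zify at this
      linarith
    -- Summing over the N flats of 𝓕 and inserting the counts outside F gives (N − 1)(countIn c' F +
    -- R) ≤ (N − 1)(countIn c F + R'); N ≥ 2 permits division.
    have hS := Finset.sum_le_sum hIH
    simp only [Finset.sum_add_distrib, Finset.sum_const, nsmul_eq_mul] at hS
    zify at hsum hsum' hcs hcs' hcard
    rw [← hsum'] at hS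
    zify
    nlinarith

/-- Kruskal's permutation lemma. -/
theorem exists_perm_of_weight_le (c : Fin R → Fin k → ℝ) (c' : Fin R' → Fin k → ℝ) (hk : 2 ≤ k)
    (hRR' : R' ≤ R) (hc : ∀ r, c r ≠ 0) (hcc : ∀ r s, r ≠ s → c s ∉ Submodule.span ℝ {c r})
    (hspan : Submodule.span ℝ (Set.range c') = ⊤)
    (H : ∀ x : Fin k → ℝ, weight (fun r => x ⬝ᵥ c' r) + k ≤ R' + 1 →
      weight (fun r => x ⬝ᵥ c r) ≤ weight (fun r => x ⬝ᵥ c' r)) :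
    R' = R ∧ ∃ (π : Fin R' → Fin R) (γ : Fin R' → ℝ), Function.Injective π ∧ (∀ r, γ r ≠ 0) ∧
      ∀ r, c' r = γ r • c (π r) := by
  classical
  have hmain : ∀ r, countIn c' (Submodule.span ℝ {c' r}) + R ≤
      countIn c (Submodule.span ℝ {c' r}) + R' := by
    intro r
    have hfr : Module.finrank ℝ (Submodule.span ℝ {c' r}) ≤ 1 :=
      (finrank_span_le_card _).trans (by simp)
    -- That `c' r` is nonzero is not known yet, so the span may have dimension 0 or 1; 2 ≤ k covers
    -- both.
    refine countIn_add_le c c' hspan H (k - 1 - Module.finrank ℝ (Submodule.span ℝ {c' r})) _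
      (by omega) ?_
    exact Submodule.span_mono (by
      rintro _ rfl
      exact ⟨Submodule.mem_span_singleton_self _, r, rfl⟩)
  have hpos : ∀ r, 1 ≤ countIn c' (Submodule.span ℝ {c' r}) := fun r =>
    Finset.card_pos.2 ⟨r, by simp⟩
  have hγ : ∀ r, ∃ s, ∃ a : ℝ, a ≠ 0 ∧ c' r = a • c s := by
    intro r
    have h1 : 0 < countIn c (Submodule.span ℝ {c' r}) := by
      have := hmain r; have := hpos r; omega
    obtain ⟨s, hs⟩ := Finset.card_pos.1 h1
    simp only [Finset.mem_filter, Finset.mem_univ, true_and] at hs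
    obtain ⟨a, ha⟩ := Submodule.mem_span_singleton.1 hs
    have ha0 : a ≠ 0 := by rintro rfl; exact hc s (by rw [← ha, zero_smul])
    exact ⟨s, a⁻¹, inv_ne_zero ha0, by rw [← ha, smul_smul, inv_mul_cancel₀ ha0, one_smul]⟩
  choose π γ hγ0 hγ using hγ
  have hspan_eq : ∀ r, Submodule.span ℝ {c' r} = Submodule.span ℝ {c (π r)} := by
    intro r
    rw [hγ r]
    exact Submodule.span_singleton_smul_eq (IsUnit.mk0 _ (hγ0 r)) _
  have hone : ∀ r, countIn c (Submodule.span ℝ {c' r}) ≤ 1 := by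
    intro r
    refine Finset.card_le_one.2 fun s hs t ht => ?_
    simp only [Finset.mem_filter, Finset.mem_univ, true_and, hspan_eq] at hs ht
    have h1 : π r = s := by by_contra h; exact hcc _ _ h hs
    have h2 : π r = t := by by_contra h; exact hcc _ _ h ht
    rw [← h1, ← h2]
  have hR' : 0 < R' := by
    rcases Nat.eq_zero_or_pos R' with h0 | h0
    · subst h0
      rw [Set.range_eq_empty, Submodule.span_empty] at hspan
      have := congrArg (fun F : Submodule ℝ (Fin k → ℝ) => Module.finrank ℝ F) hspan
      simp at this
      omega
    · exact h0
  refine ⟨?_, π, γ, ?_, hγ0, hγ⟩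
  · have := hmain ⟨0, hR'⟩
    have := hone ⟨0, hR'⟩
    have := hpos ⟨0, hR'⟩
    omega
  · intro r s hrs
    have h1 : countIn c' (Submodule.span ℝ {c' r}) ≤ 1 := by
      have := hmain r; have := hone r; omega
    refine Finset.card_le_one.1 h1 r ?_ s ?_
    · simp
    · simp only [Finset.mem_filter, Finset.mem_univ, true_and]
      rw [hspan_eq, hrs, ← hspan_eq]
      exact Submodule.mem_span_singleton_self _

end flats

/-! ### Rank and uniqueness of the decomposition -/

section generic
variable {I J K R p q : ℕ}

/-- Only q conditions are imposed on q+1 coordinates; one further zero would make q+1 of them and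
force x = 0. -/
theorem GenPos.exists_point {C : Matrix (Fin (q + 1)) (Fin R) ℝ} (hC : GenPos C)
    (W : Finset (Fin R)) (hW : W.card = q) :
    ∃ x : Fin (q + 1) → ℝ, x ≠ 0 ∧ ∀ r, x ⬝ᵥ C.col r = 0 ↔ r ∈ W := by
  classical
  obtain ⟨x, hx0, hx⟩ := exists_ne_zero_dotProduct_eq_zero C.col W (by simp [hW])
  refine ⟨x, hx0, fun r => ⟨fun h => ?_, fun h => by rw [dotProduct_comm]; exact hx r h⟩⟩
  by_contra hr
  refine hx0 (hC (insert r W) (by rw [Finset.card_insert_of_notMem hr, hW]) x fun s hs => ?_)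
  rcases Finset.mem_insert.1 hs with rfl | hs
  · exact h
  · rw [dotProduct_comm]; exact hx s hs

theorem exists_finset_card_eq_mem_notMem {n : ℕ} (r s : Fin n) (hrs : r ≠ s) (hq : 1 ≤ q)
    (hqn : q + 1 ≤ n) : ∃ W : Finset (Fin n), W.card = q ∧ r ∈ W ∧ s ∉ W := by
  obtain ⟨W, h1, h2, h3⟩ := Finset.exists_subsuperset_card_eq (s := {r}) (t := Finset.univ.erase s)
    (n := q) (by simpa using hrs) (by simpa using hq)
    (by rw [Finset.card_erase_of_mem (Finset.mem_univ _), Finset.card_univ, Fintype.card_fin]; omega)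
  exact ⟨W, h3, h1 (by simp), fun h => by simpa using h2 h⟩

theorem GenPos.col_notMem_span {C : Matrix (Fin (q + 1)) (Fin R) ℝ} (hC : GenPos C) (hq : 1 ≤ q)
    (hqR : q + 1 ≤ R) (r s : Fin R) (hrs : r ≠ s) : C.col s ∉ Submodule.span ℝ {C.col r} := by
  obtain ⟨W, hW, hrW, hsW⟩ := exists_finset_card_eq_mem_notMem r s hrs hq hqR
  obtain ⟨x, -, hx⟩ := hC.exists_point W hW
  intro h
  obtain ⟨a, ha⟩ := Submodule.mem_span_singleton.1 h
  apply hsW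
  rw [← hx, ← ha, dotProduct_smul, (hx r).2 hrW, smul_zero]

theorem GenPos.col_ne_zero {C : Matrix (Fin (q + 1)) (Fin R) ℝ} (hC : GenPos C) (hq : 1 ≤ q)
    (hqR : q + 1 ≤ R) (r : Fin R) : C.col r ≠ 0 := by
  have : Nontrivial (Fin R) := Fin.nontrivial_iff_two_le.2 (by omega)
  obtain ⟨s, hs⟩ := exists_ne r
  exact fun h => hC.col_notMem_span hq hqR s r hs (by rw [h]; exact zero_mem _)

/-- The linear combination of the frontal slices with given coefficients. -/
def slice (T : Tensor I J K) (x : Fin K → ℝ) : Matrix (Fin I) (Fin J) ℝ :=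
  Matrix.of fun i j => ∑ k, x k * T i j k

theorem slice_polyadic (A : Matrix (Fin I) (Fin R) ℝ) (B : Matrix (Fin J) (Fin R) ℝ)
    (C : Matrix (Fin K) (Fin R) ℝ) (x : Fin K → ℝ) :
    slice (polyadic A B C) x = weighted A B (fun r => x ⬝ᵥ C.col r) := by
  ext i j
  simp only [slice, polyadic, weighted, of_apply, Finset.mul_sum, dotProduct, Finset.sum_mul,
    col_apply]
  rw [Finset.sum_comm]
  exact Finset.sum_congr rfl fun r _ => Finset.sum_congr rfl fun k _ => by ring

theorem vecMul_dotProduct_col {k : ℕ} (P : Matrix (Fin k) (Fin K) ℝ) (C : Matrix (Fin K) (Fin R) ℝ)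
    (x : Fin k → ℝ) (r : Fin R) : (x ᵥ* P) ⬝ᵥ C.col r = x ⬝ᵥ (P * C).col r := by
  rw [← dotProduct_mulVec]
  rfl

theorem slice_polyadic_vecMul {k : ℕ} (A : Matrix (Fin I) (Fin R) ℝ) (B : Matrix (Fin J) (Fin R) ℝ)
    (C : Matrix (Fin K) (Fin R) ℝ) (P : Matrix (Fin k) (Fin K) ℝ) (x : Fin k → ℝ) :
    slice (polyadic A B C) (x ᵥ* P) = weighted A B (fun r => x ⬝ᵥ (P * C).col r) := by
  simp only [slice_polyadic, vecMul_dotProduct_col]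

/-- The two decompositions have equal slices, so min(weight, p+1) ≤ rank ≤ weight'. The permutation
lemma asks only about weight' ≤ p, where the minimum has to be the weight itself. -/
theorem exists_perm_of_polyadic_eq (hR : R = p + q) (hp : 1 ≤ p) (hq : 1 ≤ q)
    {A : Matrix (Fin I) (Fin R) ℝ} {B : Matrix (Fin J) (Fin R) ℝ} {C : Matrix (Fin K) (Fin R) ℝ}
    (hsep : Separates (p + 1) A B) (P : Matrix (Fin (q + 1)) (Fin K) ℝ) (hP : GenPos (P * C))
    {R' : ℕ} (hR' : R' ≤ R) (A' : Matrix (Fin I) (Fin R') ℝ) (B' : Matrix (Fin J) (Fin R') ℝ)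
    (C' : Matrix (Fin K) (Fin R') ℝ) (h : polyadic A B C = polyadic A' B' C') :
    R' = R ∧ ∃ (π : Fin R' → Fin R) (γ : Fin R' → ℝ), Function.Injective π ∧ (∀ r, γ r ≠ 0) ∧
      ∀ r, (P * C').col r = γ r • (P * C).col (π r) := by
  have hs : ∀ x : Fin (q + 1) → ℝ, weighted A B (fun r => x ⬝ᵥ (P * C).col r) =
      weighted A' B' (fun r => x ⬝ᵥ (P * C').col r) := by
    intro x
    rw [← slice_polyadic_vecMul, h, slice_polyadic_vecMul]
  apply exists_perm_of_weight_le _ _ (by omega) hR' (hP.col_ne_zero hq (by omega))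
    (fun r s hrs => hP.col_notMem_span hq (by omega) r s hrs)
  · refine span_range_eq_top _ fun x hx => ?_
    have h1 := hs x
    simp only [hx] at h1
    have h2 : weighted A' B' (fun _ => (0 : ℝ)) = 0 := by ext i j; simp [weighted]
    rw [h2] at h1
    have h3 := hsep.eq_zero (by omega) (by omega) _ h1
    obtain ⟨S, hS⟩ := Finset.exists_subset_card_eq (s := (Finset.univ : Finset (Fin R)))
      (n := q + 1) (by simp; omega)
    exact hP S hS.2 x fun r _ => congrFun h3 r
  · intro x hx
    have h1 := hsep.min_weight_le_rank (by omega) (fun r => x ⬝ᵥ (P * C).col r)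
    rw [hs x] at h1
    have h2 := weighted_rank_le A' B' (fun r => x ⬝ᵥ (P * C').col r)
    omega

/-- The row space of A diag(d) Bᵀ lies in the span of the b_r with d r ≠ 0. If the rank is at least
their number, they are linearly independent. -/
theorem eq_zero_of_weight_le_rank {A : Matrix (Fin I) (Fin R) ℝ} {B : Matrix (Fin J) (Fin R) ℝ}
    {d : Fin R → ℝ} (h : weight d ≤ (weighted A B d).rank) (y : Fin R → ℝ)
    (hy : ∀ j, ∑ r, d r * y r * B j r = 0) (r : Fin R) (hr : d r ≠ 0) : y r = 0 := by
  classical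
  set s := Finset.univ.filter fun r => d r ≠ 0 with hs
  have hspan : Submodule.span ℝ (Set.range (weighted B A d).col) ≤
      Submodule.span ℝ (Set.range fun r : s => B.col r) := by
    rw [Submodule.span_le]
    rintro _ ⟨i, rfl⟩
    have : (weighted B A d).col i = ∑ r : s, (d r * A i r) • B.col r := by
      rw [Finset.sum_coe_sort s (fun r => (d r * A i r) • B.col r)]
      ext j
      simp only [col_apply, weighted, of_apply, Finset.sum_apply, Pi.smul_apply, smul_eq_mul]
      rw [hs, Finset.sum_filter]
      refine Finset.sum_congr rfl fun r _ => ?_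
      by_cases h0 : d r = 0
      · simp [h0]
      · simp only [ne_eq, h0, not_false_eq_true, if_true]; ring
    rw [this]
    exact Submodule.sum_mem _ fun r _ => Submodule.smul_mem _ _ (Submodule.subset_span ⟨r, rfl⟩)
  have hcard : Fintype.card s ≤
      Module.finrank ℝ (Submodule.span ℝ (Set.range fun r : s => B.col r)) := by
    have h1 := Submodule.finrank_mono hspan
    rw [← rank_eq_finrank_span_cols, ← weighted_transpose, rank_transpose] at h1
    rw [Fintype.card_coe]
    exact h.trans h1
  have hind : LinearIndependent ℝ (fun r : s => B.col r) :=
    linearIndependent_iff_card_le_finrank_span.2 hcard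
  have := Fintype.linearIndependent_iff.1 hind (fun r => d r * y r) (by
    rw [Finset.sum_coe_sort s (fun r => (d r * y r) • B.col r)]
    ext j
    rw [Finset.sum_apply, Pi.zero_apply, ← hy j, hs, Finset.sum_filter]
    refine Finset.sum_congr rfl fun r _ => ?_
    by_cases h0 : d r = 0
    · simp [h0]
    · simp [h0]) ⟨r, by simpa [hs] using hr⟩
  exact (mul_eq_zero.1 this).resolve_left hr

theorem Separates.col_ne_zero {m : ℕ} {A : Matrix (Fin I) (Fin R) ℝ} {B : Matrix (Fin J) (Fin R) ℝ}
    (h : Separates m A B) {e : Fin m → Fin R} (he : Function.Injective e) (i : Fin m) :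
    ∃ j, B j (e i) ≠ 0 := by
  obtain ⟨U, V, -, -, h3⟩ := h e he
  by_contra hcon
  push Not at hcon
  have := h3 i i
  rw [Matrix.mul_apply] at this
  simp [hcon] at this

theorem exists_injective_fin_zero {m : ℕ} (r : Fin R) (hm : m + 1 ≤ R) :
    ∃ e : Fin (m + 1) → Fin R, Function.Injective e ∧ e 0 = r := by
  refine ⟨fun i => Equiv.swap r ⟨0, by omega⟩ (Fin.castLE hm i), ?_, ?_⟩
  · exact (Equiv.injective _).comp (Fin.castLE_injective hm)
  · have : Fin.castLE hm 0 = ⟨0, by omega⟩ := rfl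
    simp only [this, Equiv.swap_apply_right]

/-- The complement of all but one of the indices in the range of `e`. -/
def complErase {m : ℕ} (e : Fin m → Fin R) (i : Fin m) : Finset (Fin R) :=
  ((Finset.univ.erase i).image e)ᶜ

theorem card_complErase (hR : R = p + q) {e : Fin (p + 1) → Fin R} (he : Function.Injective e)
    (i : Fin (p + 1)) : (complErase e i).card = q := by
  rw [complErase, Finset.card_compl, Finset.card_image_of_injective _ he,
    Finset.card_erase_of_mem (Finset.mem_univ _), Finset.card_univ, Fintype.card_fin,
    Fintype.card_fin]
  omega

theorem notMem_complErase {m : ℕ} {e : Fin m → Fin R} {i : Fin m} {r : Fin R} :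
    r ∉ complErase e i ↔ ∃ a, a ≠ i ∧ e a = r := by
  simp [complErase]

/-- Let e list p+1 indices starting with π r, and let u be the row of U for which uᵀA vanishes at e
1, …, e p and is 1 at e 0. The slice at x' involves only e 1, …, e p, so u annihilates it; as this
slice has the full rank p, uᵀA' vanishes at the matching indices. The slice at x involves e 0, …, e
(p−1), and multiplying it by u leaves a multiple of b_{π r} in one decomposition and of b'_r in the
other. -/
theorem exists_col_proportional (hR : R = p + q) (hp : 1 ≤ p) (hq : 1 ≤ q)
    {A A' : Matrix (Fin I) (Fin R) ℝ} {B B' : Matrix (Fin J) (Fin R) ℝ}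
    {C : Matrix (Fin (q + 1)) (Fin R) ℝ} (hsep : Separates (p + 1) A B) (hC : GenPos C)
    (π : Fin R → Fin R) (hπ : Function.Injective π) (γ : Fin R → ℝ) (hγ : ∀ r, γ r ≠ 0)
    (h : ∀ x : Fin (q + 1) → ℝ, weighted A B (fun r => x ⬝ᵥ C.col r) =
      weighted A' B' (fun r => γ r * (x ⬝ᵥ C.col (π r)))) (r : Fin R) :
    ∃ β : ℝ, β ≠ 0 ∧ ∀ j, B j (π r) = β * B' j r := by
  classical
  obtain ⟨e, he, he0⟩ := exists_injective_fin_zero (m := p) (π r) (by omega)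
  obtain ⟨U, V, -, hU, -⟩ := hsep e he
  have h10 : Fin.last p ≠ 0 := by
    rw [Ne, Fin.ext_iff, Fin.val_last, Fin.val_zero]; omega
  obtain ⟨x', -, hx'⟩ := hC.exists_point (complErase e 0) (card_complErase hR he 0)
  obtain ⟨x, -, hx⟩ := hC.exists_point (complErase e (Fin.last p)) (card_complErase hR he _)
  have hrow : ∀ {n : ℕ} (F : Matrix (Fin I) (Fin n) ℝ) (G : Matrix (Fin J) (Fin n) ℝ) (d) (j),
      (U * weighted F G d) 0 j = ∑ t, d t * (U * F) 0 t * G j t := by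
    intro n F G d j
    simp only [Matrix.mul_apply, weighted, of_apply, Finset.mul_sum, Finset.sum_mul]
    rw [Finset.sum_comm]
    exact Finset.sum_congr rfl fun t _ => Finset.sum_congr rfl fun i _ => by ring
  have hU0 : ∀ s, (∃ a, a ≠ 0 ∧ e a = s) → (U * A) 0 s = 0 := by
    rintro _ ⟨a, ha, rfl⟩
    rw [hU, if_neg ha.symm]
  have hz : ∀ t, x' ⬝ᵥ C.col (π t) ≠ 0 → (U * A') 0 t = 0 := by
    intro t ht
    refine eq_zero_of_weight_le_rank (A := A') (B := B')
      (d := fun r => γ r * (x' ⬝ᵥ C.col (π r))) ?_ _ ?_ t (mul_ne_zero (hγ t) ht)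
    · rw [← h x']
      have h1 := hsep.min_weight_le_rank (by omega) (fun r => x' ⬝ᵥ C.col r)
      have h2 : weight (fun r => x' ⬝ᵥ C.col r) = p := by
        have : (Finset.univ.filter fun r => x' ⬝ᵥ C.col r ≠ 0) = (complErase e 0)ᶜ := by
          ext r; simp [hx']
        rw [weight, this, Finset.card_compl, card_complErase hR he, Fintype.card_fin]; omega
      have h3 : weight (fun r => γ r * (x' ⬝ᵥ C.col (π r))) ≤
          weight (fun r => x' ⬝ᵥ C.col r) := by
        rw [weight, weight]
        refine Finset.card_le_card_of_injOn π (fun t ht => ?_) hπ.injOn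
        simp only [Finset.coe_filter, Finset.mem_univ, true_and, Set.mem_ofPred_eq] at ht ⊢
        exact right_ne_zero_of_mul ht
      omega
    · intro j
      rw [← hrow, ← h x', hrow]
      refine Finset.sum_eq_zero fun s _ => ?_
      by_cases hs : x' ⬝ᵥ C.col s = 0
      · simp [hs]
      · rw [hx', notMem_complErase] at hs
        rw [hU0 s hs]; simp
  have hx0 : x ⬝ᵥ C.col (π r) ≠ 0 := by
    rw [Ne, hx, notMem_complErase]
    exact ⟨0, h10.symm, he0⟩
  have hB : ∀ j, B j (π r) = (γ r * (U * A') 0 r) * B' j r := by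
    intro j
    have h1 : (U * weighted A B (fun r => x ⬝ᵥ C.col r)) 0 j =
        (x ⬝ᵥ C.col (π r)) * B j (π r) := by
      rw [hrow, Finset.sum_eq_single (π r)]
      · rw [← he0, hU]; simp
      · intro s _ hs
        by_cases hs0 : x ⬝ᵥ C.col s = 0
        · simp [hs0]
        · rw [hx, notMem_complErase] at hs0
          obtain ⟨a, ha, rfl⟩ := hs0
          rw [hU0 _ ⟨a, fun h0 => hs (by rw [h0, he0]), rfl⟩]; simp
      · simp
    have h2 : (U * weighted A B (fun r => x ⬝ᵥ C.col r)) 0 j =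
        γ r * (x ⬝ᵥ C.col (π r)) * (U * A') 0 r * B' j r := by
      rw [h x, hrow, Finset.sum_eq_single r]
      · intro t _ htr
        by_cases ht0 : x ⬝ᵥ C.col (π t) = 0
        · simp [ht0]
        · rw [hx, notMem_complErase] at ht0
          obtain ⟨a, ha, hat⟩ := ht0
          rw [hz t]
          · simp
          · rw [Ne, hx', notMem_complErase]
            refine ⟨a, fun h0 => htr (hπ ?_), hat⟩
            rw [← hat, h0, he0]
      · simp
    rw [h1] at h2
    apply mul_left_cancel₀ hx0
    rw [h2]; ring
  refine ⟨_, ?_, hB⟩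
  intro h0
  obtain ⟨j, hj⟩ := hsep.col_ne_zero he 0
  rw [he0, hB, h0, zero_mul] at hj
  exact hj rfl

/-- Once the columns of A and B are matched up to scaling, independence of the a_r b_rᵀ determines
each row of the unprojected C. -/
theorem triviallyEquivalent_of_polyadic_eq (hR : R = p + q) (hp : 1 ≤ p) (hq : 1 ≤ q)
    {A A' : Matrix (Fin I) (Fin R) ℝ} {B B' : Matrix (Fin J) (Fin R) ℝ}
    {C C' : Matrix (Fin K) (Fin R) ℝ}
    (hsep : Separates (p + 1) A B) (P : Matrix (Fin (q + 1)) (Fin K) ℝ) (hP : GenPos (P * C))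
    (h : polyadic A B C = polyadic A' B' C') : TriviallyEquivalent A B C A' B' C' := by
  obtain ⟨-, π, γ, hπ, hγ, hC⟩ := exists_perm_of_polyadic_eq hR hp hq hsep P hP le_rfl A' B' C' h
  have hs : ∀ x : Fin (q + 1) → ℝ, weighted A B (fun r => x ⬝ᵥ (P * C).col r) =
      weighted A' B' (fun r => γ r * (x ⬝ᵥ (P * C).col (π r))) := by
    intro x
    rw [← slice_polyadic_vecMul, h, slice_polyadic_vecMul]
    simp only [hC, dotProduct_smul, smul_eq_mul]
  have hs' : ∀ x : Fin (q + 1) → ℝ, weighted B A (fun r => x ⬝ᵥ (P * C).col r) =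
      weighted B' A' (fun r => γ r * (x ⬝ᵥ (P * C).col (π r))) := by
    intro x
    rw [← weighted_transpose, hs, weighted_transpose]
  choose β hβ0 hβ using exists_col_proportional hR hp hq hsep hP π hπ γ hγ hs
  choose α hα0 hα using exists_col_proportional hR hp hq hsep.swap hP π hπ γ hγ hs'
  let σ := Equiv.ofBijective π (Finite.injective_iff_bijective.1 hπ)
  refine ⟨σ, fun r => (α r)⁻¹, fun r => (β r)⁻¹, fun r => α r * β r, fun r => ?_, fun i r => ?_,
    fun j r => ?_, fun k r => ?_⟩
  · have := hα0 r; have := hβ0 r; field_simp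
  · change A' i r = (α r)⁻¹ * A i (π r)
    rw [hα, inv_mul_cancel_left₀ (hα0 r)]
  · change B' j r = (β r)⁻¹ * B j (π r)
    rw [hβ, inv_mul_cancel_left₀ (hβ0 r)]
  · change C' k r = α r * β r * C k (π r)
    have h0 : weighted A B (fun s => C k s - (α (σ.symm s))⁻¹ * (β (σ.symm s))⁻¹ * C' k (σ.symm s))
        = 0 := by
      ext i j
      have h1 := congrFun (congrFun (congrFun h i) j) k
      simp only [polyadic] at h1
      simp only [weighted, of_apply, sub_mul, Finset.sum_sub_distrib, Matrix.zero_apply]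
      rw [sub_eq_zero]
      calc _ = ∑ r, A i r * B j r * C k r := Finset.sum_congr rfl fun r _ => by ring
        _ = _ := h1
        _ = _ := ?_
      refine Eq.trans ?_ (Equiv.sum_comp σ fun s => (α (σ.symm s))⁻¹ * (β (σ.symm s))⁻¹ *
        C' k (σ.symm s) * A i s * B j s)
      refine Finset.sum_congr rfl fun t _ => ?_
      simp only [Equiv.symm_apply_apply]
      change _ = _ * A i (π t) * B j (π t)
      rw [hα, hβ]
      have := hα0 t; have := hβ0 t
      field_simp
    have h2 := congrFun (hsep.eq_zero (by omega) (by omega) _ h0) (σ r)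
    simp only [Equiv.symm_apply_apply, Pi.zero_apply] at h2
    have h3 : C k (π r) = (α r)⁻¹ * (β r)⁻¹ * C' k r := sub_eq_zero.1 h2
    rw [h3]
    have := hα0 r; have := hβ0 r
    field_simp

theorem TriviallyEquivalent.symm {A A' : Matrix (Fin I) (Fin R) ℝ} {B B' : Matrix (Fin J) (Fin R) ℝ}
    {C C' : Matrix (Fin K) (Fin R) ℝ} (h : TriviallyEquivalent A B C A' B' C') :
    TriviallyEquivalent A' B' C' A B C := by
  obtain ⟨π, a, b, c, h1, hA, hB, hC⟩ := h
  have ha : ∀ r, a r ≠ 0 := fun r h0 => by simpa [h0] using h1 r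
  have hb : ∀ r, b r ≠ 0 := fun r h0 => by simpa [h0] using h1 r
  have hc : ∀ r, c r ≠ 0 := fun r h0 => by simpa [h0] using h1 r
  refine ⟨π.symm, fun r => (a (π.symm r))⁻¹, fun r => (b (π.symm r))⁻¹,
    fun r => (c (π.symm r))⁻¹, fun r => ?_, fun i r => ?_, fun i r => ?_, fun i r => ?_⟩
  · rw [← mul_inv, ← mul_inv, h1, inv_one]
  · rw [hA, Equiv.apply_symm_apply, inv_mul_cancel_left₀ (ha _)]
  · rw [hB, Equiv.apply_symm_apply, inv_mul_cancel_left₀ (hb _)]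
  · rw [hC, Equiv.apply_symm_apply, inv_mul_cancel_left₀ (hc _)]

theorem TriviallyEquivalent.trans {A A' A'' : Matrix (Fin I) (Fin R) ℝ}
    {B B' B'' : Matrix (Fin J) (Fin R) ℝ} {C C' C'' : Matrix (Fin K) (Fin R) ℝ}
    (h : TriviallyEquivalent A B C A' B' C') (h' : TriviallyEquivalent A' B' C' A'' B'' C'') :
    TriviallyEquivalent A B C A'' B'' C'' := by
  obtain ⟨π, a, b, c, h1, hA, hB, hC⟩ := h
  obtain ⟨π', a', b', c', h1', hA', hB', hC'⟩ := h'
  refine ⟨π'.trans π, fun r => a' r * a (π' r), fun r => b' r * b (π' r),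
    fun r => c' r * c (π' r), fun r => ?_, fun i r => ?_, fun i r => ?_, fun i r => ?_⟩
  · calc _ = (a' r * b' r * c' r) * (a (π' r) * b (π' r) * c (π' r)) := by ring
      _ = 1 := by rw [h1, h1', one_mul]
  · rw [hA', hA, Equiv.trans_apply, mul_assoc]
  · rw [hB', hB, Equiv.trans_apply, mul_assoc]
  · rw [hC', hC, Equiv.trans_apply, mul_assoc]

theorem tensorRank_polyadic (hR : R = p + q) (hp : 1 ≤ p) (hq : 1 ≤ q)
    {A : Matrix (Fin I) (Fin R) ℝ} {B : Matrix (Fin J) (Fin R) ℝ} {C : Matrix (Fin K) (Fin R) ℝ}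
    (hsep : Separates (p + 1) A B) (P : Matrix (Fin (q + 1)) (Fin K) ℝ) (hP : GenPos (P * C)) :
    tensorRank (polyadic A B C) = R := by
  have hmem : R ∈ {R' : ℕ | ∃ (A' : Matrix (Fin I) (Fin R') ℝ) (B' : Matrix (Fin J) (Fin R') ℝ)
    (C' : Matrix (Fin K) (Fin R') ℝ), polyadic A B C = polyadic A' B' C'} := ⟨A, B, C, rfl⟩
  obtain ⟨A', B', C', h⟩ := Nat.sInf_mem ⟨R, hmem⟩
  exact (exists_perm_of_polyadic_eq hR hp hq hsep P hP (Nat.sInf_le hmem) A' B' C' h).1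

theorem cpdUnique_polyadic (hR : R = p + q) (hp : 1 ≤ p) (hq : 1 ≤ q)
    {A : Matrix (Fin I) (Fin R) ℝ} {B : Matrix (Fin J) (Fin R) ℝ} {C : Matrix (Fin K) (Fin R) ℝ}
    (hsep : Separates (p + 1) A B) (P : Matrix (Fin (q + 1)) (Fin K) ℝ) (hP : GenPos (P * C)) :
    CPDUnique (polyadic A B C) := by
  rintro R' A₁ A₂ B₁ B₂ C₁ C₂ ⟨h1, h1'⟩ ⟨h2, -⟩
  rw [tensorRank_polyadic hR hp hq hsep P hP] at h1'
  subst h1'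
  exact (triviallyEquivalent_of_polyadic_eq hR hp hq hsep P hP h1).symm.trans
    (triviallyEquivalent_of_polyadic_eq hR hp hq hsep P hP h2)

end generic

/-! ### Forms, rational sample points and expansions of determinants -/

/-- The monomial function with the given multiset of variables. -/
def mono {k d : ℕ} (s : Sym (Fin k) d) (x : Fin k → ℝ) : ℝ := ((s : Multiset (Fin k)).map x).prod

/-- The space of homogeneous polynomial functions of degree `d` in `k` variables. -/
def forms (k d : ℕ) : Submodule ℝ ((Fin k → ℝ) → ℝ) := 
  Submodule.span ℝ (Set.range (mono (d := d)))

section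
variable {k d : ℕ}

instance : FiniteDimensional ℝ (forms k d) := FiniteDimensional.span_of_finite ℝ (Set.finite_range _)

theorem finrank_forms_le : Module.finrank ℝ (forms k d) ≤ Fintype.card (Sym (Fin k) d) :=
  finrank_range_le_card _

theorem one_mem_forms : (fun _ => 1 : (Fin k → ℝ) → ℝ) ∈ forms k 0 :=
  Submodule.subset_span ⟨Sym.nil, by ext; simp [mono]⟩

theorem linear_mul_mem_forms (c : Fin k → ℝ) {f : (Fin k → ℝ) → ℝ} (hf : f ∈ forms k d) :
    (fun x => (c ⬝ᵥ x) * f x) ∈ forms k (d + 1) := by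
  induction hf using Submodule.span_induction with
  | mem f hf =>
    obtain ⟨s, rfl⟩ := hf
    have : (fun x => (c ⬝ᵥ x) * mono s x) = ∑ i, c i • mono (i ::ₛ s) := by
      ext x
      simp only [dotProduct, mono, Finset.sum_apply, Pi.smul_apply, smul_eq_mul, Sym.coe_cons,
        Multiset.map_cons, Multiset.prod_cons, Finset.sum_mul, mul_assoc]
    rw [this]
    exact Submodule.sum_mem _ fun i _ => Submodule.smul_mem _ _ (Submodule.subset_span ⟨_, rfl⟩)
  | zero =>
    simp only [Pi.zero_apply, mul_zero]
    exact Submodule.zero_mem _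
  | add f g _ _ hf hg =>
    have := Submodule.add_mem _ hf hg
    convert this using 1
    ext x
    simp [mul_add]
  | smul a f _ hf =>
    have := Submodule.smul_mem _ a hf
    convert this using 1
    ext x
    simp only [Pi.smul_apply, smul_eq_mul]
    ring

theorem prod_mem_forms {ι : Type*} (s : Finset ι) (c : ι → Fin k → ℝ) :
    (fun x => ∏ i ∈ s, c i ⬝ᵥ x) ∈ forms k s.card := by
  classical
  induction s using Finset.induction_on with
  | empty => simpa using one_mem_forms
  | insert a s ha ih =>
    rw [Finset.card_insert_of_notMem ha]
    simp only [Finset.prod_insert ha]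
    exact linear_mul_mem_forms _ ih

theorem det_mem_forms {m : ℕ} (L : Fin m → Fin m → Fin k → ℝ) :
    (fun x => (Matrix.of fun i j => L i j ⬝ᵥ x).det) ∈ forms k m := by
  have : (fun x => (Matrix.of fun i j => L i j ⬝ᵥ x).det) = ∑ σ : Equiv.Perm (Fin m),
      ((Equiv.Perm.sign σ : ℤ) : ℝ) • fun x => ∏ i, L (σ i) i ⬝ᵥ x := by
    ext x
    simp only [det_apply', of_apply, Finset.sum_apply, Pi.smul_apply, smul_eq_mul]
  rw [this]
  refine Submodule.sum_mem _ fun σ _ => Submodule.smul_mem _ _ ?_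
  simpa using prod_mem_forms (Finset.univ : Finset (Fin m)) (fun i => L (σ i) i)

theorem continuous_of_mem_forms {f : (Fin k → ℝ) → ℝ} (hf : f ∈ forms k d) : Continuous f := by
  induction hf using Submodule.span_induction with
  | mem f hf =>
    obtain ⟨s, rfl⟩ := hf
    exact continuous_multiset_prod _ fun i _ => continuous_apply i
  | zero => exact continuous_const
  | add f g _ _ hf hg => exact hf.add hg
  | smul a f _ hf => exact hf.const_smul a

/-- Forms are continuous and rational points are dense. Rational points are wanted because sample
points become constants of the program. -/
theorem eq_zero_of_forall_rat {f : (Fin k → ℝ) → ℝ} (hf : f ∈ forms k d)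
    (h : ∀ y : Fin k → ℚ, f (fun i => y i) = 0) : f = 0 := by
  have hd : DenseRange (fun y : Fin k → ℚ => (fun i => (y i : ℝ))) :=
    DenseRange.piMap fun _ => Rat.denseRange_cast
  exact hd.equalizer (continuous_of_mem_forms hf) continuous_const (funext h)

end

/-- A finite-dimensional function space that is separated by a set of points is separated by as many
of these points as its dimension. -/
theorem exists_unisolvent {X Z : Type*} [Nonempty Z] (z : Z → X) (D : ℕ) :
    ∀ V : Submodule ℝ (X → ℝ), FiniteDimensional ℝ V → Module.finrank ℝ V ≤ D →
      (∀ f ∈ V, (∀ a, f (z a) = 0) → f = 0) →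
      ∃ y : Fin D → Z, ∀ f ∈ V, (∀ i, f (z (y i)) = 0) → f = 0 := by
  induction D with
  | zero =>
    intro V _ hV _
    have := Submodule.finrank_eq_zero.1 (Nat.le_zero.1 hV)
    exact ⟨Fin.elim0, fun f hf _ => by rw [this] at hf; exact (Submodule.mem_bot ℝ).1 hf⟩
  | succ D ih =>
    intro V hfd hV hsep
    by_cases hbot : V = ⊥
    · exact ⟨fun _ => Classical.arbitrary Z, fun f hf _ => by
        rw [hbot] at hf; exact (Submodule.mem_bot ℝ).1 hf⟩
    · obtain ⟨f₀, hf₀, hne⟩ := Submodule.exists_mem_ne_zero_of_ne_bot hbot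
      obtain ⟨a, ha⟩ : ∃ a, f₀ (z a) ≠ 0 := by
        by_contra hcon
        push Not at hcon
        exact hne (hsep f₀ hf₀ hcon)
      -- Vanishing at a point where f₀ is nonzero cuts out a proper subspace, so one point lowers
      -- the dimension.
      let V' : Submodule ℝ (X → ℝ) := V ⊓ LinearMap.ker (LinearMap.proj (R := ℝ) (z a))
      have hV' : V' < V := lt_of_le_of_ne inf_le_left fun h => ha (by
        rw [← h] at hf₀
        exact (Submodule.mem_inf.1 hf₀).2)
      obtain ⟨y, hy⟩ := ih V' (Submodule.finiteDimensional_of_le hV'.le) (by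
        have := Submodule.finrank_lt_finrank_of_lt hV'; omega)
        fun f hf h => hsep f (Submodule.mem_inf.1 hf).1 h
      refine ⟨Fin.cons a y, fun f hf h => hy f (Submodule.mem_inf.2 ⟨hf, h 0⟩) fun i => h i.succ⟩

theorem exists_rat_unisolvent {ι : Type*} [Fintype ι] (k d : ℕ)
    (hι : Fintype.card (Sym (Fin k) d) ≤ Fintype.card ι) :
    ∃ Y : ι → Fin k → ℚ, ∀ f ∈ forms k d, (∀ i, f (fun j => Y i j) = 0) → f = 0 := by
  obtain ⟨y, hy⟩ := exists_unisolvent (fun (y : Fin k → ℚ) (i : Fin k) => (y i : ℝ))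
    (Fintype.card ι) (forms k d) inferInstance (finrank_forms_le.trans hι)
    fun f hf h => eq_zero_of_forall_rat hf h
  refine ⟨fun i => y (Fintype.equivFin ι i), fun f hf h => hy f hf fun i => ?_⟩
  have := h ((Fintype.equivFin ι).symm i)
  simpa only [Equiv.apply_symm_apply] using this

/-- A Cauchy–Binet expansion over all maps instead of increasing sequences; it is just
multilinearity in the rows. -/
theorem det_mul_eq_sum_submatrix {m n : ℕ} (U : Matrix (Fin m) (Fin n) ℝ)
    (X : Matrix (Fin n) (Fin m) ℝ) :
    (U * X).det = ∑ P : Fin m → Fin n, (∏ i, U i (P i)) * (X.submatrix P id).det := by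
  have e1 : U * X = fun i => ∑ a, U i a • X a := by
    ext i j
    simp [Matrix.mul_apply, Finset.sum_apply]
  rw [e1]
  refine ((detRowAlternating (R := ℝ) (n := Fin m)).toMultilinearMap.map_sum
    (fun i a => U i a • X a)).trans ?_
  refine Finset.sum_congr rfl fun P _ => ?_
  exact MultilinearMap.map_smul_univ _ (fun i => U i (P i)) (fun i => X (P i))

theorem det_mul_mul_transpose_eq_sum {m n l : ℕ} (U : Matrix (Fin m) (Fin n) ℝ)
    (M : Matrix (Fin n) (Fin l) ℝ) (V : Matrix (Fin m) (Fin l) ℝ) :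
    (U * M * Vᵀ).det = ∑ PQ : (Fin m → Fin n) × (Fin m → Fin l),
      ((∏ i, U i (PQ.1 i)) * ∏ i, V i (PQ.2 i)) * (M.submatrix PQ.1 PQ.2).det := by
  rw [Matrix.mul_assoc, det_mul_eq_sum_submatrix, Fintype.sum_prod_type]
  refine Finset.sum_congr rfl fun P _ => ?_
  have : ((M * Vᵀ).submatrix P id).det = (V * (M.submatrix P id)ᵀ).det := by
    rw [← det_transpose]
    congr 1
    ext i j
    simp only [transpose_apply, submatrix_apply, Matrix.mul_apply, id]
    exact Finset.sum_congr rfl fun a _ => mul_comm _ _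
  rw [this, det_mul_eq_sum_submatrix, Finset.mul_sum]
  refine Finset.sum_congr rfl fun Q _ => ?_
  rw [← det_transpose ((M.submatrix P id)ᵀ.submatrix Q id), mul_assoc]
  rfl

/-! ### The pencil of multiplication by linear forms modulo minors -/

/-- Index sets for the `m`-subsets of the columns. -/
abbrev ColSet (R m : ℕ) : Type := {S : Finset (Fin R) // S.card = m}

section
variable {I J R p q : ℕ}

theorem card_sym_eq_card_colSet (hR : R = p + q) :
    Fintype.card (ColSet R q) = Fintype.card (Sym (Fin (q + 1)) p) := by
  rw [Fintype.card_finset_len, Sym.card_sym_eq_choose, Fintype.card_fin, Fintype.card_fin,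
    show q + 1 + p - 1 = R by omega]
  exact Nat.choose_symm_of_eq_add (by omega)

/-- Pascal's rule. The number of monomials of degree p+1 equals the number of products over
(p+1)-sets plus the number of points x_W. -/
theorem card_sym_eq_card_sum (hR : R = p + q) :
    Fintype.card (Sym (Fin (q + 1)) (p + 1)) =
      Fintype.card (ColSet R (p + 1) ⊕ ColSet R q) := by
  rw [Fintype.card_sum, Fintype.card_finset_len, Fintype.card_finset_len, Sym.card_sym_eq_choose,
    Fintype.card_fin, Fintype.card_fin, show q + 1 + (p + 1) - 1 = R + 1 by omega,
    Nat.choose_succ_succ, Nat.choose_symm_of_eq_add (show R = p + q by omega)]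
  ring

/-- Take points x₁, x₂ that vanish exactly on Sᶜ ∪ {r₁} and Sᶜ ∪ {r₂}, for distinct r₁, r₂ in S.
They have no common zero in S, so x₁ + t x₂ has none for a suitable t. -/
theorem GenPos.exists_point_compl {C : Matrix (Fin (q + 1)) (Fin R) ℝ} (hR : R = p + q)
    (hp : 1 ≤ p) (hq : 1 ≤ q) (hC : GenPos C) (S : ColSet R (p + 1)) :
    ∃ z : Fin (q + 1) → ℝ, ∀ r, C.col r ⬝ᵥ z = 0 ↔ r ∉ S.1 := by
  classical
  obtain ⟨S, hS⟩ := S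
  obtain ⟨r₁, r₂, h₁, h₂, h₁₂⟩ := Finset.one_lt_card_iff.1 (show 1 < S.card by omega)
  have hcard : ∀ r ∈ S, (insert r Sᶜ).card = q := by
    intro r hr
    rw [Finset.card_insert_of_notMem (by simpa using hr), Finset.card_compl, Fintype.card_fin]
    omega
  obtain ⟨x₁, -, hx₁⟩ := hC.exists_point _ (hcard r₁ h₁)
  obtain ⟨x₂, -, hx₂⟩ := hC.exists_point _ (hcard r₂ h₂)
  obtain ⟨t, ht⟩ := exists_moment_ne_zero (fun r : S => ![x₁ ⬝ᵥ C.col r, x₂ ⬝ᵥ C.col r])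
    (by
      intro r h0
      have e1 : x₁ ⬝ᵥ C.col r = 0 := congrFun h0 0
      have e2 : x₂ ⬝ᵥ C.col r = 0 := congrFun h0 1
      rw [hx₁] at e1
      rw [hx₂] at e2
      simp only [Finset.mem_insert, Finset.mem_compl, r.2, not_true_eq_false, or_false] at e1 e2
      exact h₁₂ (e1.symm.trans e2)) (Nat.lt_succ_self _)
  refine ⟨x₁ + (t : ℝ) • x₂, fun r => ?_⟩
  have e3 : C.col r ⬝ᵥ (x₁ + (t : ℝ) • x₂) = moment 2 t ⬝ᵥ ![x₁ ⬝ᵥ C.col r, x₂ ⬝ᵥ C.col r] := by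
    rw [dotProduct_comm, add_dotProduct, smul_dotProduct]
    simp [moment, dotProduct, Fin.sum_univ_two]
  constructor
  · intro h hr
    exact ht ⟨r, hr⟩ (by rw [← e3, h])
  · intro hr
    have e1 : x₁ ⬝ᵥ C.col r = 0 := (hx₁ r).2 (by simp [hr])
    have e2 : x₂ ⬝ᵥ C.col r = 0 := (hx₂ r).2 (by simp [hr])
    rw [e3, e1, e2]
    simp [dotProduct]

/-- Products of linear forms, multiples of which form a basis of the space of forms of degree
`p + 1`. -/
def productForm (C : Matrix (Fin (q + 1)) (Fin R) ℝ) (ℓ : Fin (q + 1) → ℝ) :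
    ColSet R (p + 1) ⊕ ColSet R q → (Fin (q + 1) → ℝ) → ℝ
  | .inl S => fun y => ∏ r ∈ S.1, C.col r ⬝ᵥ y
  | .inr W => fun y => (ℓ ⬝ᵥ y) * ∏ r ∈ W.1ᶜ, C.col r ⬝ᵥ y

theorem card_compl_colSet (hR : R = p + q) (W : ColSet R q) : (W.1ᶜ).card = p := by
  rw [Finset.card_compl, W.2, Fintype.card_fin]; omega

theorem productForm_mem (hR : R = p + q) (C : Matrix (Fin (q + 1)) (Fin R) ℝ)
    (ℓ : Fin (q + 1) → ℝ) (i : ColSet R (p + 1) ⊕ ColSet R q) :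
    productForm C ℓ i ∈ forms (q + 1) (p + 1) := by
  rcases i with S | W
  · have := prod_mem_forms S.1 C.col
    rwa [S.2] at this
  · have := prod_mem_forms W.1ᶜ C.col
    rw [card_compl_colSet hR] at this
    exact linear_mul_mem_forms ℓ this

/-- |S| + |W| = R + 1, so S and W meet. -/
theorem productForm_inl_point (hR : R = p + q) (C : Matrix (Fin (q + 1)) (Fin R) ℝ)
    (ℓ : Fin (q + 1) → ℝ) (S : ColSet R (p + 1)) (W : ColSet R q) {x : Fin (q + 1) → ℝ}
    (hx : ∀ r, x ⬝ᵥ C.col r = 0 ↔ r ∈ W.1) : productForm C ℓ (.inl S) x = 0 := by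
  obtain ⟨r, hr⟩ : (S.1 ∩ W.1).Nonempty := by
    refine Finset.inter_nonempty_of_card_lt_card_add_card (s := Finset.univ) (Finset.subset_univ _)
      (Finset.subset_univ _) ?_
    rw [S.2, W.2, Finset.card_univ, Fintype.card_fin]; omega
  rw [Finset.mem_inter] at hr
  exact Finset.prod_eq_zero hr.1 (by rw [dotProduct_comm, hx]; exact hr.2)

theorem exists_mem_notMem_of_card_eq {n : ℕ} {s t : ColSet R n} (h : s ≠ t) :
    ∃ r ∈ s.1, r ∉ t.1 := by
  by_contra hcon
  push Not at hcon
  exact h (Subtype.ext (Finset.eq_of_subset_of_card_le hcon (by rw [s.2, t.2])))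

theorem prod_compl_point (C : Matrix (Fin (q + 1)) (Fin R) ℝ)
    (W W' : ColSet R q) {x : Fin (q + 1) → ℝ} (hx : ∀ r, x ⬝ᵥ C.col r = 0 ↔ r ∈ W.1) :
    ∏ r ∈ W'.1ᶜ, C.col r ⬝ᵥ x = 0 ↔ W' ≠ W := by
  constructor
  · rintro h rfl
    obtain ⟨r, hr, h0⟩ := Finset.prod_eq_zero_iff.1 h
    rw [dotProduct_comm, hx] at h0
    exact (Finset.mem_compl.1 hr) h0
  · intro h
    obtain ⟨r, hr, hr'⟩ := exists_mem_notMem_of_card_eq h.symm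
    exact Finset.prod_eq_zero (Finset.mem_compl.2 hr') (by rw [dotProduct_comm, hx]; exact hr)

/-- Evaluation is triangular. At x_W every product over a (p+1)-set vanishes, and among the forms
ℓ·∏ only the one for W survives. Afterwards a point whose nonzero pairings are exactly those with S
isolates the product over S. -/
theorem productForm_linearIndependent (hR : R = p + q) (hp : 1 ≤ p) (hq : 1 ≤ q)
    {C : Matrix (Fin (q + 1)) (Fin R) ℝ} (hC : GenPos C) {x : ColSet R q → Fin (q + 1) → ℝ}
    (hx : ∀ W r, x W ⬝ᵥ C.col r = 0 ↔ r ∈ W.1) {ℓ : Fin (q + 1) → ℝ} (hℓ : ∀ W, ℓ ⬝ᵥ x W ≠ 0)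
    (v : ColSet R (p + 1) ⊕ ColSet R q → ℝ) (h : ∀ y, ∑ i, v i * productForm C ℓ i y = 0) :
    v = 0 := by
  classical
  have h1 : ∀ W, v (.inr W) = 0 := by
    intro W
    have := h (x W)
    rw [Fintype.sum_sum_type, Finset.sum_eq_zero (fun S _ => by
      rw [productForm_inl_point hR C ℓ S W (hx W), mul_zero]), zero_add,
      Finset.sum_eq_single W] at this
    · refine (mul_eq_zero.1 this).resolve_right (mul_ne_zero (hℓ W) ?_)
      rw [Ne, prod_compl_point C W W (hx W)]
      simp
    · intro W' _ hW'
      simp only [productForm]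
      rw [(prod_compl_point C W W' (hx W)).2 hW', mul_zero, mul_zero]
    · simp
  ext i
  rcases i with S | W
  · obtain ⟨z, hz⟩ := hC.exists_point_compl hR hp hq S
    have := h z
    rw [Fintype.sum_sum_type, Finset.sum_eq_zero (s := (Finset.univ : Finset (ColSet R q)))
      (fun W _ => by rw [h1, zero_mul]), add_zero, Finset.sum_eq_single S] at this
    · refine (mul_eq_zero.1 this).resolve_right (Finset.prod_ne_zero_iff.2 fun r hr => ?_)
      rw [Ne, hz, not_not]
      exact hr
    · intro S' _ hS'
      obtain ⟨r, hr, hr'⟩ := exists_mem_notMem_of_card_eq hS'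
      have : productForm C ℓ (.inl S') z = 0 := Finset.prod_eq_zero hr ((hz r).2 hr')
      rw [this, mul_zero]
    · simp
  · exact h1 W

/-- The `p+1`-minors of a pencil of matrices as forms. -/
def minorForm (M : (Fin (q + 1) → ℝ) → Matrix (Fin I) (Fin J) ℝ)
    (PQ : (Fin (p + 1) → Fin I) × (Fin (p + 1) → Fin J)) (y : Fin (q + 1) → ℝ) : ℝ :=
  ((M y).submatrix PQ.1 PQ.2).det

theorem minorForm_mem (A : Matrix (Fin I) (Fin R) ℝ) (B : Matrix (Fin J) (Fin R) ℝ)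
    (C : Matrix (Fin (q + 1)) (Fin R) ℝ)
    (PQ : (Fin (p + 1) → Fin I) × (Fin (p + 1) → Fin J)) :
    minorForm (fun y => weighted A B (fun r => y ⬝ᵥ C.col r)) PQ ∈ forms (q + 1) (p + 1) := by
  have := det_mem_forms (fun i j : Fin (p + 1) => ∑ r, (A (PQ.1 i) r * B (PQ.2 j) r) • C.col r)
  convert this using 1
  ext y
  rw [minorForm]
  congr 1
  ext i j
  simp only [submatrix_apply, weighted, of_apply, sum_dotProduct, smul_dotProduct, smul_eq_mul]
  refine Finset.sum_congr rfl fun r _ => ?_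
  rw [dotProduct_comm]
  ring

theorem submatrix_weighted_det_eq_zero {m : ℕ} (A : Matrix (Fin I) (Fin R) ℝ)
    (B : Matrix (Fin J) (Fin R) ℝ) (d : Fin R → ℝ) (hd : weight d < m) (P : Fin m → Fin I)
    (Q : Fin m → Fin J) : ((weighted A B d).submatrix P Q).det = 0 := by
  have e : (weighted A B d).submatrix P Q = weighted (A.submatrix P id) (B.submatrix Q id) d := rfl
  rw [e]
  by_contra h
  have h1 := rank_of_det_ne_zero h
  have h2 := weighted_rank_le (A.submatrix P id) (B.submatrix Q id) d
  rw [Fintype.card_fin] at h1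
  omega

theorem weight_point (hR : R = p + q) (C : Matrix (Fin (q + 1)) (Fin R) ℝ) (W : ColSet R q)
    {x : Fin (q + 1) → ℝ} (hx : ∀ r, x ⬝ᵥ C.col r = 0 ↔ r ∈ W.1) :
    weight (fun r => x ⬝ᵥ C.col r) = p := by
  classical
  have : (Finset.univ.filter fun r => x ⬝ᵥ C.col r ≠ 0) = W.1ᶜ := by ext r; simp [hx]
  rw [weight, this, card_compl_colSet hR]

/-- The product over S is det(U M(y) Vᵀ) for separating U and V; its expansion into minors of M(y)
has coefficients independent of y. -/
theorem exists_productForm_eq_sum_minorForm {A : Matrix (Fin I) (Fin R) ℝ}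
    {B : Matrix (Fin J) (Fin R) ℝ} (hsep : Separates (p + 1) A B)
    (C : Matrix (Fin (q + 1)) (Fin R) ℝ) (ℓ : Fin (q + 1) → ℝ) (S : ColSet R (p + 1)) :
    ∃ g : (Fin (p + 1) → Fin I) × (Fin (p + 1) → Fin J) → ℝ, ∀ y,
      productForm C ℓ (.inl S) y =
        ∑ PQ, g PQ * minorForm (fun y => weighted A B (fun r => y ⬝ᵥ C.col r)) PQ y := by
  obtain ⟨U, V, h, -, -⟩ := hsep (fun i => S.1.orderEmbOfFin S.2 i) (S.1.orderEmbOfFin S.2).injective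
  refine ⟨_, fun y => Eq.trans ?_
    (det_mul_mul_transpose_eq_sum U (weighted A B fun r => y ⬝ᵥ C.col r) V)⟩
  rw [h, det_diagonal]
  change ∏ r ∈ S.1, C.col r ⬝ᵥ y =
    ∏ i, y ⬝ᵥ C.col ((S.1.orderIsoOfFin S.2).toEquiv i : Fin R)
  rw [(S.1.orderIsoOfFin S.2).toEquiv.prod_comp (fun r : S.1 => y ⬝ᵥ C.col (r : Fin R)),
    Finset.prod_coe_sort S.1 (fun r => y ⬝ᵥ C.col r)]
  exact Finset.prod_congr rfl fun r _ => dotProduct_comm _ _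

variable (Y : ColSet R (p + 1) ⊕ ColSet R q → Fin (q + 1) → ℝ)

/-- Values of selected minors at the sample points, completed by unit vectors. -/
def minorMatrix (M : (Fin (q + 1) → ℝ) → Matrix (Fin I) (Fin J) ℝ)
    (sel : ColSet R (p + 1) → (Fin (p + 1) → Fin I) × (Fin (p + 1) → Fin J))
    (ysel : ColSet R q → ColSet R (p + 1) ⊕ ColSet R q) :
    Matrix (ColSet R (p + 1) ⊕ ColSet R q) (ColSet R (p + 1) ⊕ ColSet R q) ℝ :=
  Matrix.of fun a i => match i with
    | .inl S => minorForm M (sel S) (Y a)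
    | .inr W => if a = ysel W then 1 else 0

/-- Multiplication by the linear form `ℓ`, from forms of degree `p` to forms of degree `p + 1`
modulo minors. -/
noncomputable def pencil (M : (Fin (q + 1) → ℝ) → Matrix (Fin I) (Fin J) ℝ)
    (sel : ColSet R (p + 1) → (Fin (p + 1) → Fin I) × (Fin (p + 1) → Fin J))
    (ysel : ColSet R q → ColSet R (p + 1) ⊕ ColSet R q) (eB : ColSet R q → Sym (Fin (q + 1)) p)
    (ℓ : Fin (q + 1) → ℝ) : Matrix (ColSet R q) (ColSet R q) ℝ :=
  Matrix.of fun W W' => ∑ a, (minorMatrix Y M sel ysel)⁻¹ (.inr W) a *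
    ((ℓ ⬝ᵥ Y a) * mono (eB W') (Y a))

/-- The product forms, evaluated at the sample points, give an invertible matrix. Its columns are
combinations of columns of minors or of unit vectors, so multilinearity of the determinant allows
each column to be replaced by a single minor or unit vector. Unlike the product forms, these are
available to the program. -/
theorem exists_selection_minorMatrix (hR : R = p + q) (hp : 1 ≤ p) (hq : 1 ≤ q)
    {A : Matrix (Fin I) (Fin R) ℝ} {B : Matrix (Fin J) (Fin R) ℝ} (hsep : Separates (p + 1) A B)
    {C : Matrix (Fin (q + 1)) (Fin R) ℝ} (hC : GenPos C) {x : ColSet R q → Fin (q + 1) → ℝ}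
    (hx : ∀ W r, x W ⬝ᵥ C.col r = 0 ↔ r ∈ W.1) {ℓ : Fin (q + 1) → ℝ} (hℓ : ∀ W, ℓ ⬝ᵥ x W ≠ 0)
    (hY : ∀ f ∈ forms (q + 1) (p + 1), (∀ a, f (Y a) = 0) → f = 0) :
    (Matrix.of fun a i => productForm C ℓ i (Y a)).det ≠ 0 ∧ ∃ sel ysel,
      (minorMatrix Y (fun y => weighted A B (fun r => y ⬝ᵥ C.col r)) sel ysel).det ≠ 0 := by
  have hG : (Matrix.of fun a i => productForm C ℓ i (Y a)).det ≠ 0 := by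
    intro h0
    obtain ⟨v, hv, hv0⟩ := exists_mulVec_eq_zero_iff.2 h0
    apply hv
    refine productForm_linearIndependent hR hp hq hC hx hℓ v fun y => ?_
    have hmem : (∑ i, v i • productForm C ℓ i) ∈ forms (q + 1) (p + 1) :=
      Submodule.sum_mem _ fun i _ => Submodule.smul_mem _ _ (productForm_mem hR C ℓ i)
    have := hY _ hmem (fun a => by
      have := congrFun hv0 a
      simp only [mulVec, dotProduct, of_apply, Pi.zero_apply] at this
      simp only [Finset.sum_apply, Pi.smul_apply, smul_eq_mul]
      rw [← this]
      exact Finset.sum_congr rfl fun i _ => mul_comm _ _)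
    simpa [Finset.sum_apply] using congrFun this y
  refine ⟨hG, ?_⟩
  choose g hg using exists_productForm_eq_sum_minorForm hsep C ℓ
  let α : ColSet R (p + 1) ⊕ ColSet R q → Type :=
    Sum.elim (fun _ => (Fin (p + 1) → Fin I) × (Fin (p + 1) → Fin J))
      (fun _ => ColSet R (p + 1) ⊕ ColSet R q)
  let inst₁ : Fintype ((Fin (p + 1) → Fin I) × (Fin (p + 1) → Fin J)) := inferInstance
  let inst₂ : Fintype (ColSet R (p + 1) ⊕ ColSet R q) := inferInstance
  let inst : ∀ i, Fintype (α i) := fun i => match i with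
    | .inl _ => inst₁
    | .inr _ => inst₂
  let G : ∀ i, α i → ℝ := fun i => match i with
    | .inl S => g S
    | .inr W => fun a => productForm (p := p) C ℓ (.inr W) (Y a)
  let w : ∀ i, α i → ColSet R (p + 1) ⊕ ColSet R q → ℝ := fun i => match i with
    | .inl _ => fun PQ a => minorForm (fun y => weighted A B (fun r => y ⬝ᵥ C.col r)) PQ (Y a)
    | .inr _ => fun (b : ColSet R (p + 1) ⊕ ColSet R q) a => if a = b then 1 else 0
  obtain ⟨Q, hQ⟩ := exists_selection_det_ne_zero G w (by
    convert hG using 3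
    ext a i
    rcases i with S | W
    · exact (hg S (Y a)).symm
    · change ∑ b, productForm C ℓ (.inr W) (Y b) * (if a = b then 1 else 0) = _
      simp)
  refine ⟨fun S => Q (.inl S), fun W => Q (.inr W), ?_⟩
  convert hQ using 2
  ext a i
  rcases i with S | W <;> rfl

/-- Every form f of degree p+1 is a combination of the selected minors and of forms h_W that
interpolate unit vectors; Λ f are the coefficients of the h_W. Evaluation at x_W' kills the minors,
so H Λ f lists the values of f at these points. For f = ℓ times a monomial this is the asserted
factorization. -/
theorem exists_pencil_factorization (hR : R = p + q) (hp : 1 ≤ p) (hq : 1 ≤ q)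
    {A : Matrix (Fin I) (Fin R) ℝ} {B : Matrix (Fin J) (Fin R) ℝ} (hsep : Separates (p + 1) A B)
    {C : Matrix (Fin (q + 1)) (Fin R) ℝ} (hC : GenPos C) {x : ColSet R q → Fin (q + 1) → ℝ}
    (hx : ∀ W r, x W ⬝ᵥ C.col r = 0 ↔ r ∈ W.1) {ℓ₀ : Fin (q + 1) → ℝ}
    (hℓ₀ : ∀ W, ℓ₀ ⬝ᵥ x W ≠ 0)
    (hY : ∀ f ∈ forms (q + 1) (p + 1), (∀ a, f (Y a) = 0) → f = 0)
    (eB : ColSet R q ≃ Sym (Fin (q + 1)) p) :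
    ∃ sel ysel, ∃ H F : Matrix (ColSet R q) (ColSet R q) ℝ, H.det ≠ 0 ∧ F.det ≠ 0 ∧ ∀ ℓ,
      H * pencil Y (fun y => weighted A B (fun r => y ⬝ᵥ C.col r)) sel ysel eB ℓ =
        diagonal (fun W => ℓ ⬝ᵥ x W) * F := by
  classical
  obtain ⟨hG, sel, ysel, hdet⟩ := exists_selection_minorMatrix Y hR hp hq hsep hC hx hℓ₀ hY
  set M : (Fin (q + 1) → ℝ) → Matrix (Fin I) (Fin J) ℝ :=
    fun y => weighted A B (fun r => y ⬝ᵥ C.col r) with hM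
  set N := minorMatrix Y M sel ysel with hN
  set G : Matrix _ _ ℝ := Matrix.of fun a i => productForm C ℓ₀ i (Y a) with hGdef
  have hinterp : ∀ v : ColSet R (p + 1) ⊕ ColSet R q → ℝ,
      ∃ f ∈ forms (q + 1) (p + 1), ∀ a, f (Y a) = v a := by
    intro v
    refine ⟨∑ i, (G⁻¹ *ᵥ v) i • productForm C ℓ₀ i, Submodule.sum_mem _ fun i _ =>
      Submodule.smul_mem _ _ (productForm_mem hR C ℓ₀ i), fun a => ?_⟩
    have h1 : (G *ᵥ (G⁻¹ *ᵥ v)) a = v a := by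
      rw [mulVec_mulVec, mul_nonsing_inv _ hG.isUnit, one_mulVec]
    rw [← h1]
    change _ = ∑ i, productForm C ℓ₀ i (Y a) * (G⁻¹ *ᵥ v) i
    simp only [Finset.sum_apply, Pi.smul_apply, smul_eq_mul]
    exact Finset.sum_congr rfl fun i _ => mul_comm _ _
  choose h hmem hY1 using fun W => hinterp (fun a => if a = ysel W then 1 else 0)
  let H : Matrix (ColSet R q) (ColSet R q) ℝ := Matrix.of fun W' W => h W (x W')
  let Λ : ((Fin (q + 1) → ℝ) → ℝ) → ColSet R q → ℝ := fun f W => ∑ a, N⁻¹ (.inr W) a * f (Y a)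
  have key : ∀ f ∈ forms (q + 1) (p + 1), ∀ W', (H *ᵥ Λ f) W' = f (x W') := by
    intro f hf W'
    let γ := N⁻¹ *ᵥ (fun a => f (Y a))
    have hγ : N *ᵥ γ = fun a => f (Y a) := by
      rw [mulVec_mulVec, mul_nonsing_inv _ hdet.isUnit, one_mulVec]
    have hz : f - (∑ S, γ (.inl S) • minorForm M (sel S) + ∑ W, γ (.inr W) • h W) = 0 := by
      refine hY _ (Submodule.sub_mem _ hf (Submodule.add_mem _ ?_ ?_)) fun a => ?_
      · exact Submodule.sum_mem _ fun S _ => Submodule.smul_mem _ _ (minorForm_mem A B C _)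
      · exact Submodule.sum_mem _ fun W _ => Submodule.smul_mem _ _ (hmem W)
      · have h1 := congrFun hγ a
        rw [Pi.sub_apply, ← h1, sub_eq_zero]
        change ∑ i, N a i * γ i = _
        rw [Fintype.sum_sum_type]
        simp only [Pi.add_apply, Finset.sum_apply, Pi.smul_apply, smul_eq_mul, hY1]
        congr 1
        · exact Finset.sum_congr rfl fun S _ => mul_comm _ _
        · exact Finset.sum_congr rfl fun S _ => mul_comm _ _
    have hz1 := congrFun (sub_eq_zero.1 hz) (x W')
    rw [hz1]
    simp only [Pi.add_apply, Finset.sum_apply, Pi.smul_apply, smul_eq_mul]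
    rw [Finset.sum_eq_zero (s := (Finset.univ : Finset (ColSet R (p + 1)))), zero_add]
    · change ∑ W, h W (x W') * γ (.inr W) = _
      exact Finset.sum_congr rfl fun W _ => mul_comm _ _
    · intro S _
      have : minorForm M (sel S) (x W') = 0 :=
        submatrix_weighted_det_eq_zero A B _ (by rw [weight_point hR C W' (hx W')]; omega) _ _
      rw [this, mul_zero]
  let F : Matrix (ColSet R q) (ColSet R q) ℝ := Matrix.of fun W W' => mono (eB W') (x W)
  refine ⟨sel, ysel, H, F, ?_, ?_, fun ℓ => ?_⟩
  -- On the forms ℓ₀ ∏ over Wᶜ evaluation at the points is diagonal without zeros, so H has a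
  -- nonzero determinant.
  · let L : Matrix (ColSet R q) (ColSet R q) ℝ :=
      Matrix.of fun W W' => Λ (productForm (p := p) C ℓ₀ (.inr W')) W
    have hHL : H * L = diagonal (fun W => productForm (p := p) C ℓ₀ (.inr W) (x W)) := by
      ext W W'
      refine (key _ (productForm_mem hR C ℓ₀ (.inr W')) W).trans ?_
      rw [diagonal_apply]
      split_ifs with hWW
      · rw [hWW]
      · change _ * _ = _
        rw [(prod_compl_point C W W' (hx W)).2 (Ne.symm hWW), mul_zero]
    intro h0
    have := congrArg Matrix.det hHL
    rw [det_mul, h0, zero_mul, det_diagonal, eq_comm, Finset.prod_eq_zero_iff] at this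
    obtain ⟨W, -, hW⟩ := this
    refine mul_ne_zero (hℓ₀ W) ?_ hW
    rw [Ne, prod_compl_point C W W (hx W)]
    simp
  -- In degree p the products over Wᶜ play the role of Lagrange polynomials for the points x_W.
  · have hθ : ∀ W : ColSet R q, ∃ θ : Sym (Fin (q + 1)) p → ℝ, ∀ y,
        ∑ b, θ b * mono b y = ∏ r ∈ W.1ᶜ, C.col r ⬝ᵥ y := by
      intro W
      have := prod_mem_forms W.1ᶜ C.col
      rw [card_compl_colSet hR, forms, Submodule.mem_span_range_iff_exists_fun] at this
      obtain ⟨θ, hθ⟩ := this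
      refine ⟨θ, fun y => ?_⟩
      rw [← congrFun hθ y]
      simp [Finset.sum_apply]
    choose θ hθ using hθ
    let Θ : Matrix (ColSet R q) (ColSet R q) ℝ := Matrix.of fun W W' => θ W' (eB W)
    have hFΘ : F * Θ = diagonal (fun W => ∏ r ∈ W.1ᶜ, C.col r ⬝ᵥ x W) := by
      ext W W'
      have h1 : (F * Θ) W W' = ∏ r ∈ W'.1ᶜ, C.col r ⬝ᵥ x W := by
        rw [← hθ W' (x W), ← eB.sum_comp, Matrix.mul_apply]
        exact Finset.sum_congr rfl fun W'' _ => mul_comm _ _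
      rw [h1, diagonal_apply]
      split_ifs with hWW
      · rw [hWW]
      · exact (prod_compl_point C W W' (hx W)).2 (Ne.symm hWW)
    intro h0
    have := congrArg Matrix.det hFΘ
    rw [det_mul, h0, zero_mul, det_diagonal, eq_comm, Finset.prod_eq_zero_iff] at this
    obtain ⟨W, -, hW⟩ := this
    exact (prod_compl_point C W W (hx W)).1 hW rfl
  · ext W W'
    rw [diagonal_mul]
    exact key (fun y => (ℓ ⬝ᵥ y) * mono (eB W') y)
      (linear_mul_mem_forms ℓ (Submodule.subset_span ⟨_, rfl⟩)) W

end

/-! ### Uniqueness of generalized eigenvectors -/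

/-- A generalized eigenvector basis of a pencil with distinct eigenvalues is unique up to order
and scaling. -/
theorem gevd_of_factorization {n : ℕ} {P Q H F : Matrix (Fin n) (Fin n) ℝ} {l₁ l₂ : Fin n → ℝ}
    (hH : H.det ≠ 0) (hF : F.det ≠ 0) (hP : H * P = diagonal l₂ * F) (hQ : H * Q = diagonal l₁ * F)
    (h₁ : ∀ i, l₁ i ≠ 0) (h₂ : ∀ i j, i ≠ j → l₂ i * l₁ j ≠ l₂ j * l₁ i) :
    (∃ V α β, IsGEVD P Q V α β) ∧ ∀ V α β, IsGEVD P Q V α β →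
      ∃ (τ : Fin n → Fin n) (g : Fin n → ℝ), Function.Bijective τ ∧ (∀ i, g i ≠ 0) ∧
        ∀ w i, (F * V) w i = if w = τ i then g i else 0 := by
  have hHu : IsUnit H.det := hH.isUnit
  have hFu : IsUnit F.det := hF.isUnit
  have hcancel : ∀ X X' : Matrix (Fin n) (Fin n) ℝ, H * X = H * X' → X = X' := by
    intro X X' h
    rw [← nonsing_inv_mul_cancel_left H X hHu, h, nonsing_inv_mul_cancel_left H X' hHu]
  constructor
  · refine ⟨F⁻¹, l₂, l₁, ⟨0, 1, ?_⟩, ?_, fun i => Or.inr (h₁ i), hcancel _ _ ?_⟩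
    · rw [zero_smul, zero_add, one_smul]
      intro h0
      have := congrArg Matrix.det hQ
      rw [det_mul, h0, mul_zero, det_mul, det_diagonal] at this
      exact mul_ne_zero (Finset.prod_ne_zero_iff.2 fun i _ => h₁ i) hF this.symm
    · rw [det_nonsing_inv, Ring.inverse_eq_inv']
      exact inv_ne_zero hF
    · rw [← Matrix.mul_assoc, ← Matrix.mul_assoc, hP, ← Matrix.mul_assoc, ← Matrix.mul_assoc, hQ,
        mul_nonsing_inv_cancel_right _ _ hFu, mul_nonsing_inv_cancel_right _ _ hFu,
        diagonal_mul_diagonal, diagonal_mul_diagonal]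
      congr 1
      ext i
      exact mul_comm _ _
  · rintro V α β ⟨-, hV, hαβ, hPQ⟩
    set G := F * V with hGdef
    have hG : G.det ≠ 0 := by rw [det_mul]; exact mul_ne_zero hF hV
    -- In the coordinates G = F V the pencil is diagonal. A nonzero entry in row w of column i fixes
    -- the ratio of (α_i, β_i), and the ratios for different rows are distinct, so each column has
    -- only one nonzero entry.
    have hent : ∀ w i, l₂ w * G w i * β i = l₁ w * G w i * α i := by
      intro w i
      have h1 : diagonal l₂ * G * diagonal β = diagonal l₁ * G * diagonal α := by
        have := congrArg (H * ·) hPQ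
        simp only [← Matrix.mul_assoc, hP, hQ] at this
        simpa only [hGdef, ← Matrix.mul_assoc] using this
      have := congrFun (congrFun h1 w) i
      simpa only [mul_diagonal, diagonal_mul] using this
    have huniq : ∀ i w w', G w i ≠ 0 → G w' i ≠ 0 → w = w' := by
      intro i w w' hw hw'
      by_contra hne
      have e1 : l₂ w * β i = l₁ w * α i := by
        apply mul_right_cancel₀ hw; linear_combination hent w i
      have e2 : l₂ w' * β i = l₁ w' * α i := by
        apply mul_right_cancel₀ hw'; linear_combination hent w' i
      have hβ : β i = 0 := by
        have h3 : (l₂ w * l₁ w' - l₂ w' * l₁ w) * β i = 0 := by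
          linear_combination l₁ w' * e1 - l₁ w * e2
        exact (mul_eq_zero.1 h3).resolve_left (sub_ne_zero.2 (h₂ w w' hne))
      have hα : α i = 0 := by
        rw [hβ, mul_zero, eq_comm] at e1
        exact (mul_eq_zero.1 e1).resolve_left (h₁ w)
      exact (hαβ i).elim (fun h => h hα) (fun h => h hβ)
    have hex : ∀ i, ∃ w, G w i ≠ 0 := by
      intro i
      by_contra hcon
      push Not at hcon
      exact hG (det_eq_zero_of_column_eq_zero i hcon)
    choose τ hτ using hex
    have hGτ : ∀ w i, G w i = if w = τ i then G (τ i) i else 0 := by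
      intro w i
      split_ifs with h
      · rw [h]
      · by_contra hne
        exact h (huniq i w (τ i) hne (hτ i))
    have hinj : Function.Injective τ := by
      intro i j hij
      by_contra hne
      apply hG
      rw [← exists_mulVec_eq_zero_iff]
      -- Two columns supported in the same row are linearly dependent.
      refine ⟨G (τ j) j • Pi.single i 1 - G (τ i) i • Pi.single j 1, fun h0 => ?_, ?_⟩
      · have := congrFun h0 i
        simp [hne] at this
        exact hτ j this
      · ext w
        rw [mulVec_sub, mulVec_smul, mulVec_smul, mulVec_single_one, mulVec_single_one]
        simp only [Pi.sub_apply, Pi.smul_apply, col_apply, smul_eq_mul, Pi.zero_apply]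
        rw [hGτ w i, hGτ w j, hij]
        split_ifs <;> ring
    exact ⟨τ, fun i => G (τ i) i, Finite.injective_iff_bijective.1 hinj, hτ, hGτ⟩

/-! ### Recovery of the factor matrices from slices -/

section recovery
variable {I J K R p q : ℕ}

/-- A multiple of a column of `B`, if `M` and `M'` are weighted sums whose weights have supports of
cardinality `p` that differ in one index only. -/
noncomputable def recoverCol (M' M : Matrix (Fin I) (Fin J) ℝ) (P : Fin (p + 1) → Fin I)
    (Q : Fin (p + 1) → Fin J) (j : Fin J) : ℝ :=
  (M'.submatrix P Q).cramer (fun a => M (P a) j) 0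

/-- With d s ≠ 0, the column a_s equals d_s a_s · (1/d_s), so after the replacement the matrix is
still a weighted sum with the same weights, of which there are too few. -/
theorem cramer_weighted_eq_zero (A : Matrix (Fin I) (Fin R) ℝ) (B : Matrix (Fin J) (Fin R) ℝ)
    {d : Fin R → ℝ} (hd : weight d < p + 1) (P : Fin (p + 1) → Fin I) (Q : Fin (p + 1) → Fin J)
    (s : Fin R) (hs : d s ≠ 0) :
    ((weighted A B d).submatrix P Q).cramer (fun a => A (P a) s) 0 = 0 := by
  classical
  rw [cramer_apply]
  have e : ((weighted A B d).submatrix P Q).updateCol 0 (fun a => A (P a) s) =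
      (weighted (A.submatrix P id) (Matrix.of fun b r => if b = 0 then (if r = s then 1 / d r else 0)
        else B (Q b) r) d).submatrix id id := by
    ext a b
    by_cases hb : b = 0
    · simp only [updateCol_apply, hb, weighted, of_apply, submatrix_apply, if_true, id]
      rw [Finset.sum_eq_single s]
      · rw [if_pos rfl]; field_simp
      · intro r _ hr; simp [hr]
      · simp
    · simp [hb, weighted]
  rw [e]
  exact submatrix_weighted_det_eq_zero _ _ d hd _ _

/-- Let Z have the first column a_{e 0} and the other columns of M Vᵀ. Then U Z is an invertible
diagonal matrix. Expanding its determinant in U selects the rows P, expanding the columns of M Vᵀ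
selects Q. -/
theorem exists_cramer_ne_zero {A : Matrix (Fin I) (Fin R) ℝ} {B : Matrix (Fin J) (Fin R) ℝ}
    (hsep : Separates (p + 1) A B) {e : Fin (p + 1) → Fin R} (he : Function.Injective e)
    {d : Fin R → ℝ} (hd : ∀ a, a ≠ 0 → d (e a) ≠ 0) :
    ∃ (P : Fin (p + 1) → Fin I) (Q : Fin (p + 1) → Fin J),
      ((weighted A B d).submatrix P Q).cramer (fun a => A (P a) (e 0)) 0 ≠ 0 := by
  classical
  obtain ⟨U, V, h, hU, -⟩ := hsep e he
  -- Column 0 gets replaced, so its index in Q is irrelevant; j₀ only provides some index.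
  obtain ⟨j₀, -⟩ := hsep.col_ne_zero he 0
  set M := weighted A B d with hM
  let Z : Matrix (Fin I) (Fin (p + 1)) ℝ :=
    Matrix.of fun i b => if b = 0 then A i (e 0) else (M * Vᵀ) i b
  have hUZ : U * Z = diagonal (fun a => if a = 0 then 1 else d (e a)) := by
    ext a b
    by_cases hb : b = 0
    · have h1 : (U * Z) a b = (U * A) a (e 0) := by
        simp only [Matrix.mul_apply, Z, of_apply, hb, if_true]
      rw [h1, hU, hb, diagonal_apply]
      by_cases ha : a = 0 <;> simp [ha]
    · have h1 : (U * Z) a b = (U * M * Vᵀ) a b := by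
        rw [Matrix.mul_assoc, Matrix.mul_apply, Matrix.mul_apply]
        simp only [Z, of_apply, hb, if_false]
      rw [h1, h, diagonal_apply, diagonal_apply]
      split_ifs with hab h0
      · exact absurd (hab.symm.trans h0) hb
      · rfl
      · rfl
  have hdet : (U * Z).det ≠ 0 := by
    rw [hUZ, det_diagonal]
    refine Finset.prod_ne_zero_iff.2 fun a _ => ?_
    split_ifs with h0
    · exact one_ne_zero
    · exact hd a h0
  rw [det_mul_eq_sum_submatrix] at hdet
  obtain ⟨P, -, hP⟩ := Finset.exists_ne_zero_of_sum_ne_zero hdet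
  have hP' := right_ne_zero_of_mul hP
  obtain ⟨Q, hQ⟩ := exists_selection_det_ne_zero
    (fun (b : Fin (p + 1)) (j : Fin J) => if b = 0 then (if j = j₀ then 1 else 0) else V b j)
    (fun b j a => if b = 0 then A (P a) (e 0) else M (P a) j) (by
      convert hP' using 2
      ext a b
      by_cases hb : b = 0
      · simp [hb, Z]
      · simp only [hb, if_false, of_apply, submatrix_apply, id, Z, Matrix.mul_apply,
          transpose_apply]
        exact Finset.sum_congr rfl fun j _ => mul_comm _ _)
  refine ⟨P, Q, ?_⟩
  rw [cramer_apply]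
  convert hQ using 2
  ext a b
  simp [updateCol_apply]

/-- Cramer's expression is linear in the inserted column, which is Σ d_s b_{js} a_s. The support of
d is e 0, …, e (p−1) and that of d' is e 1, …, e p. Terms with s in both supports vanish, so only s
= e 0 contributes, with a factor independent of j. -/
theorem exists_recoverCol {A : Matrix (Fin I) (Fin R) ℝ} {B : Matrix (Fin J) (Fin R) ℝ}
    (hsep : Separates (p + 1) A B) {e : Fin (p + 1) → Fin R} (he : Function.Injective e)
    (hp : 1 ≤ p) {d' d : Fin R → ℝ} (hd' : ∀ s, d' s = 0 ↔ s ∈ complErase e 0)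
    (hd : ∀ s, d s = 0 ↔ s ∈ complErase e (Fin.last p)) (hw : weight d' < p + 1) :
    ∃ (P : Fin (p + 1) → Fin I) (Q : Fin (p + 1) → Fin J) (κ : ℝ), κ ≠ 0 ∧
      ∀ j, recoverCol (weighted A B d') (weighted A B d) P Q j = κ * B j (e 0) := by
  obtain ⟨P, Q, hPQ⟩ := exists_cramer_ne_zero hsep he (d := d') (fun a ha => by
    rw [Ne, hd', notMem_complErase]; exact ⟨a, ha, rfl⟩)
  have hlast : (0 : Fin (p + 1)) ≠ Fin.last p := by
    rw [Ne, Fin.ext_iff, Fin.val_last, Fin.val_zero]; omega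
  have hd0 : d (e 0) ≠ 0 := by
    rw [Ne, hd, notMem_complErase]; exact ⟨0, hlast, rfl⟩
  refine ⟨P, Q, _, mul_ne_zero hd0 hPQ, fun j => ?_⟩
  have hcol : (fun a => weighted A B d (P a) j) =
      ∑ s, (d s * B j s) • (fun a => A (P a) s) := by
    ext a
    simp only [weighted, of_apply, Finset.sum_apply, Pi.smul_apply, smul_eq_mul]
    exact Finset.sum_congr rfl fun s _ => by ring
  rw [recoverCol, hcol, map_sum, Finset.sum_apply, Finset.sum_eq_single (e 0)]
  · rw [map_smul, Pi.smul_apply, smul_eq_mul]; ring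
  · intro s _ hs
    rw [map_smul, Pi.smul_apply, smul_eq_mul]
    by_cases h0 : d s = 0
    · rw [h0, zero_mul, zero_mul]
    · rw [hd, notMem_complErase] at h0
      obtain ⟨a, -, rfl⟩ := h0
      rw [cramer_weighted_eq_zero A B hw, mul_zero]
      rw [Ne, hd', notMem_complErase]
      exact ⟨a, fun h => hs (by rw [h]), rfl⟩
  · simp

/-- The least squares solution for the third factor matrix. -/
noncomputable def solveThird (A : Matrix (Fin I) (Fin R) ℝ) (B : Matrix (Fin J) (Fin R) ℝ)
    (T : Tensor I J K) : Matrix (Fin K) (Fin R) ℝ :=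
  Matrix.of fun k r => ∑ s, (Matrix.of fun r s : Fin R =>
    ∑ ij : Fin I × Fin J, (A ij.1 r * B ij.2 r) * (A ij.1 s * B ij.2 s))⁻¹ r s *
      ∑ ij : Fin I × Fin J, (A ij.1 s * B ij.2 s) * T ij.1 ij.2 k

/-- The Gram matrix of the a'_r ⊗ b'_r is invertible since these are independent, so the normal
equations return C with the scalings α, β divided out. -/
theorem polyadic_solveThird {m : ℕ} {A : Matrix (Fin I) (Fin R) ℝ} {B : Matrix (Fin J) (Fin R) ℝ}
    (hsep : Separates m A B) (hm : m ≤ R) (hm0 : 0 < m) (C : Matrix (Fin K) (Fin R) ℝ)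
    {A' : Matrix (Fin I) (Fin R) ℝ} {B' : Matrix (Fin J) (Fin R) ℝ} {α β : Fin R → ℝ}
    (hα : ∀ r, α r ≠ 0) (hβ : ∀ r, β r ≠ 0) (hA : ∀ i r, A' i r = α r * A i r)
    (hB : ∀ j r, B' j r = β r * B j r) :
    polyadic A' B' (solveThird A' B' (polyadic A B C)) = polyadic A B C := by
  let X : Matrix (Fin I × Fin J) (Fin R) ℝ := Matrix.of fun ij r => A' ij.1 r * B' ij.2 r
  have hG : (Xᵀ * X).det ≠ 0 := by
    intro h0
    obtain ⟨v, hv, hv0⟩ := exists_mulVec_eq_zero_iff.2 h0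
    have h1 : X *ᵥ v = 0 := by
      rw [← dotProduct_self_eq_zero, ← vecMul_transpose, ← dotProduct_mulVec, vecMul_transpose,
        mulVec_mulVec, hv0, dotProduct_zero]
    apply hv
    have h2 : weighted A B (fun r => v r * (α r * β r)) = 0 := by
      ext i j
      have := congrFun h1 (i, j)
      simp only [mulVec, dotProduct, X, of_apply, Pi.zero_apply, hA, hB] at this
      rw [Matrix.zero_apply, ← this]
      simp only [weighted, of_apply]
      exact Finset.sum_congr rfl fun r _ => by ring
    ext r
    have := congrFun (hsep.eq_zero hm hm0 _ h2) r
    exact (mul_eq_zero.1 this).resolve_right (mul_ne_zero (hα r) (hβ r))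
  have hT : ∀ i j k, polyadic A B C i j k = (X *ᵥ fun r => C k r / (α r * β r)) (i, j) := by
    intro i j k
    simp only [polyadic, mulVec, dotProduct, X, of_apply, hA, hB]
    refine Finset.sum_congr rfl fun r _ => ?_
    have := hα r; have := hβ r
    field_simp
  have hS : ∀ k r, solveThird A' B' (polyadic A B C) k r = C k r / (α r * β r) := by
    intro k r
    have h1 : solveThird A' B' (polyadic A B C) k r =
        ((Xᵀ * X)⁻¹ *ᵥ (Xᵀ *ᵥ (X *ᵥ fun r => C k r / (α r * β r)))) r := by
      simp only [solveThird, of_apply, hT]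
      rfl
    rw [h1, mulVec_mulVec, mulVec_mulVec, Matrix.mul_assoc, nonsing_inv_mul _ hG.isUnit, one_mulVec]
  ext i j k
  rw [hT]
  simp only [polyadic, hS]
  rfl

end recovery

/-! ### Computability of the recovery formulas -/

section comp
variable {I J K n : ℕ}

/-- The rational numbers as a subring of the reals. -/
noncomputable abbrev ratSubring : Subring ℝ := (Rat.castHom ℝ).range

theorem Comp.of_mem_range {x : ℝ} (hx : x ∈ ratSubring) :
    Comp (fun (_ : Tensor I J K) (_ : Matrix (Fin n) (Fin n) ℝ) => x) := by
  obtain ⟨y, rfl⟩ := hx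
  exact Comp.ratCast y

theorem moment_mem_range (k t : ℕ) (i : Fin k) : moment k t i ∈ ratSubring :=
  pow_mem (natCast_mem _ t) _

theorem mono_mem_range {k d : ℕ} (s : Sym (Fin k) d) (y : Fin k → ℝ)
    (hy : ∀ i, y i ∈ ratSubring) : mono s y ∈ ratSubring :=
  multiset_prod_mem _ fun x hx => by
    obtain ⟨i, -, rfl⟩ := Multiset.mem_map.1 hx
    exact hy i

theorem dotProduct_mem_range {k : ℕ} (x y : Fin k → ℝ) (hx : ∀ i, x i ∈ ratSubring)
    (hy : ∀ i, y i ∈ ratSubring) : x ⬝ᵥ y ∈ ratSubring :=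
  sum_mem fun i _ => mul_mem (hx i) (hy i)

theorem Comp.slice {x : Tensor I J K → Matrix (Fin n) (Fin n) ℝ → Fin K → ℝ}
    (hx : ∀ k, Comp (fun T V => x T V k)) (i : Fin I) (j : Fin J) :
    Comp (fun T V => CPDecomp.slice T (x T V) i j) := by
  simp only [CPDecomp.slice, of_apply]
  exact Comp.sum Finset.univ fun k => (hx k).mul (Comp.tensor i j k)

theorem Comp.vecMul_momentMatrix {k N : ℕ} (t : Fin k → Fin N)
    {x : Tensor I J K → Matrix (Fin n) (Fin n) ℝ → Fin k → ℝ}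
    (hx : ∀ k, Comp (fun T V => x T V k)) (j : Fin K) :
    Comp (fun T V => (x T V ᵥ* momentMatrix K t) j) := by
  simp only [vecMul, dotProduct]
  exact Comp.sum Finset.univ fun a => (hx a).mul (Comp.of_mem_range (moment_mem_range _ _ _))

theorem Comp.solveThird {R : ℕ}
    {A : Tensor I J K → Matrix (Fin n) (Fin n) ℝ → Matrix (Fin I) (Fin R) ℝ}
    {B : Tensor I J K → Matrix (Fin n) (Fin n) ℝ → Matrix (Fin J) (Fin R) ℝ}
    (hA : ∀ i r, Comp (fun T V => A T V i r)) (hB : ∀ j r, Comp (fun T V => B T V j r))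
    (k : Fin K) (r : Fin R) : Comp (fun T V => CPDecomp.solveThird (A T V) (B T V) T k r) := by
  simp only [CPDecomp.solveThird, of_apply]
  refine Comp.sum Finset.univ fun s => (Comp.matInv (fun a b => ?_) r s).mul ?_
  · simp only [of_apply]
    exact Comp.sum Finset.univ fun ij => ((hA _ _).mul (hB _ _)).mul ((hA _ _).mul (hB _ _))
  · exact Comp.sum Finset.univ fun ij => ((hA _ _).mul (hB _ _)).mul (Comp.tensor _ _ _)

theorem Comp.recoverCol {p : ℕ}
    {M' M : Tensor I J K → Matrix (Fin n) (Fin n) ℝ → Matrix (Fin I) (Fin J) ℝ}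
    (hM' : ∀ i j, Comp (fun T V => M' T V i j)) (hM : ∀ i j, Comp (fun T V => M T V i j))
    (P : Fin (p + 1) → Fin I) (Q : Fin (p + 1) → Fin J) (j : Fin J) :
    Comp (fun T V => CPDecomp.recoverCol (M' T V) (M T V) P Q j) :=
  Comp.cramer (fun _ _ => hM' _ _) (fun _ => hM _ _) 0

theorem Comp.recoverCol_transpose {p : ℕ}
    {M' M : Tensor I J K → Matrix (Fin n) (Fin n) ℝ → Matrix (Fin I) (Fin J) ℝ}
    (hM' : ∀ i j, Comp (fun T V => M' T V i j)) (hM : ∀ i j, Comp (fun T V => M T V i j))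
    (P : Fin (p + 1) → Fin J) (Q : Fin (p + 1) → Fin I) (i : Fin I) :
    Comp (fun T V => CPDecomp.recoverCol (M' T V)ᵀ (M T V)ᵀ P Q i) :=
  Comp.cramer (fun _ _ => hM' _ _) (fun _ => hM _ _) 0

end comp

/-! ### The stages of the algorithm -/

section stage
variable {I J K R p q : ℕ}

/-- Linear combination of the slices after projection of the third mode. -/
def projSlice {N : ℕ} (t : Fin (q + 1) → Fin N) (T : Tensor I J K) (y : Fin (q + 1) → ℝ) :
    Matrix (Fin I) (Fin J) ℝ := slice T (y ᵥ* momentMatrix K t)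

/-- Rational sample points that separate the forms of degree `p + 1`. -/
noncomputable def samplePoints (hR : R = p + q) :
    ColSet R (p + 1) ⊕ ColSet R q → Fin (q + 1) → ℚ :=
  (exists_rat_unisolvent (q + 1) (p + 1) (card_sym_eq_card_sum hR).le).choose

/-- The sample points, as real points. -/
noncomputable def samplePointsReal (hR : R = p + q) (a : ColSet R (p + 1) ⊕ ColSet R q)
    (j : Fin (q + 1)) : ℝ := samplePoints hR a j

theorem eq_zero_of_samplePoints (hR : R = p + q) :
    ∀ f ∈ forms (q + 1) (p + 1), (∀ a, f (samplePointsReal hR a) = 0) → f = 0 :=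
  (exists_rat_unisolvent (q + 1) (p + 1) (card_sym_eq_card_sum hR).le).choose_spec

/-- The choices that are made before the GEVD. -/
abbrev PencilChoice (I J K R p q : ℕ) : Type :=
  (Fin (q + 1) → Fin (Fintype.card (ColSet R (q + 1)) * K + 1)) ×
  (ColSet R (p + 1) → (Fin (p + 1) → Fin I) × (Fin (p + 1) → Fin J)) ×
  (ColSet R q → ColSet R (p + 1) ⊕ ColSet R q) ×
  Fin (Fintype.card (ColSet R q) * (q + 1) + 1) ×
  Fin (Fintype.card {W : ColSet R q × ColSet R q // W.1 ≠ W.2} * (q + 1) + 1)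

/-- The choices that are made after the GEVD. -/
abbrev FactorChoice (I J R p n : ℕ) : Type :=
  (Fin n → Fin n) × (Fin R → Fin n × Fin n) ×
  (Fin R → (Fin (p + 1) → Fin I) × (Fin (p + 1) → Fin J)) ×
  (Fin R → (Fin (p + 1) → Fin J) × (Fin (p + 1) → Fin I))

/-- The pencil with numbered rows and columns. -/
noncomputable def finPencil (hR : R = p + q) (c : PencilChoice I J K R p q) (T : Tensor I J K)
    (ℓ : Fin (q + 1) → ℝ) :
    Matrix (Fin (Fintype.card (ColSet R q))) (Fin (Fintype.card (ColSet R q))) ℝ :=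
  (pencil (samplePointsReal hR) (projSlice c.1 T) c.2.1 c.2.2.1
    (Fintype.equivOfCardEq (card_sym_eq_card_colSet hR)) ℓ).submatrix
      (Fintype.equivFin (ColSet R q)).symm (Fintype.equivFin (ColSet R q)).symm

/-- The point in the dual of the third mode that belongs to a generalized eigenvector. -/
noncomputable def eigenPoint (hR : R = p + q) (c : PencilChoice I J K R p q)
    (ρ : Fin (Fintype.card (ColSet R q)) → Fin (Fintype.card (ColSet R q))) (T : Tensor I J K)
    (V : Matrix (Fin (Fintype.card (ColSet R q))) (Fin (Fintype.card (ColSet R q))) ℝ)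
    (i : Fin (Fintype.card (ColSet R q))) (k : Fin (q + 1)) : ℝ :=
  (finPencil hR c T (Pi.single k 1) * V) (ρ i) i

/-- The candidate for the second factor matrix. -/
noncomputable def factorB (hR : R = p + q) (c : PencilChoice I J K R p q)
    (g : FactorChoice I J R p (Fintype.card (ColSet R q))) (T : Tensor I J K)
    (V : Matrix (Fin (Fintype.card (ColSet R q))) (Fin (Fintype.card (ColSet R q))) ℝ) :
    Matrix (Fin J) (Fin R) ℝ :=
  Matrix.of fun j r => recoverCol (projSlice c.1 T (eigenPoint hR c g.1 T V (g.2.1 r).1))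
    (projSlice c.1 T (eigenPoint hR c g.1 T V (g.2.1 r).2)) (g.2.2.1 r).1 (g.2.2.1 r).2 j

/-- The candidate for the first factor matrix. -/
noncomputable def factorA (hR : R = p + q) (c : PencilChoice I J K R p q)
    (g : FactorChoice I J R p (Fintype.card (ColSet R q))) (T : Tensor I J K)
    (V : Matrix (Fin (Fintype.card (ColSet R q))) (Fin (Fintype.card (ColSet R q))) ℝ) :
    Matrix (Fin I) (Fin R) ℝ :=
  Matrix.of fun i r => recoverCol (projSlice c.1 T (eigenPoint hR c g.1 T V (g.2.1 r).1))ᵀ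
    (projSlice c.1 T (eigenPoint hR c g.1 T V (g.2.1 r).2))ᵀ (g.2.2.2 r).1 (g.2.2.2 r).2 i

theorem Comp.finPencil {n : ℕ} (hR : R = p + q) (c : PencilChoice I J K R p q)
    {ℓ : Fin (q + 1) → ℝ} (hℓ : ∀ i, ℓ i ∈ ratSubring)
    (i j : Fin (Fintype.card (ColSet R q))) :
    Comp (fun T (_ : Matrix (Fin n) (Fin n) ℝ) => CPDecomp.finPencil hR c T ℓ i j) := by
  have hY : ∀ a b, samplePointsReal hR a b ∈ ratSubring := fun a b => ⟨samplePoints hR a b, rfl⟩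
  simp only [CPDecomp.finPencil, pencil, submatrix_apply, of_apply]
  refine Comp.sum Finset.univ fun a => (Comp.matInv (fun b l => ?_) _ _).mul
    (Comp.of_mem_range (mul_mem (dotProduct_mem_range _ _ hℓ (hY a)) (mono_mem_range _ _ (hY a))))
  rcases l with S | W
  · simp only [minorMatrix, of_apply, minorForm]
    refine Comp.det fun a' b' => ?_
    exact Comp.slice (fun k => Comp.vecMul_momentMatrix c.1
      (x := fun _ _ => samplePointsReal hR b) (fun k => Comp.of_mem_range (hY b k)) k) _ _
  · simp only [minorMatrix, of_apply]
    refine Comp.of_mem_range ?_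
    split_ifs
    · exact one_mem _
    · exact zero_mem _

theorem Comp.projSlice_eigenPoint (hR : R = p + q) (c : PencilChoice I J K R p q)
    (ρ : Fin (Fintype.card (ColSet R q)) → Fin (Fintype.card (ColSet R q)))
    (a : Fin (Fintype.card (ColSet R q))) (i : Fin I) (j : Fin J) :
    Comp (fun T V => projSlice c.1 T (eigenPoint hR c ρ T V a) i j) := by
  refine Comp.slice (fun k => Comp.vecMul_momentMatrix c.1 (fun k => ?_) k) _ _
  simp only [eigenPoint, Matrix.mul_apply]
  refine Comp.sum Finset.univ fun b => (Comp.finPencil hR c (fun l => ?_) _ _).mul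
    (Comp.matrix _ _)
  rw [Pi.single_apply]
  split_ifs
  · exact one_mem _
  · exact zero_mem _

/-- The algorithm for given numbers `p` and `q` and given choices before the GEVD. -/
noncomputable def pencilStage (hR : R = p + q) (c : PencilChoice I J K R p q) : Stage I J K R where
  n := Fintype.card (ColSet R q)
  P := fun T => finPencil hR c T (moment (q + 1) c.2.2.2.2)
  Q := fun T => finPencil hR c T (moment (q + 1) c.2.2.2.1)
  ι := FactorChoice I J R p (Fintype.card (ColSet R q))
  fin := inferInstance
  A := fun g T V => factorA hR c g T V
  B := fun g T V => factorB hR c g T V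
  C := fun g T V => solveThird (factorA hR c g T V) (factorB hR c g T V) T
  compP := fun i j => Comp.finPencil hR c (fun _ => moment_mem_range _ _ _) i j
  compQ := fun i j => Comp.finPencil hR c (fun _ => moment_mem_range _ _ _) i j
  compA := fun _ i _ => Comp.recoverCol_transpose (Comp.projSlice_eigenPoint hR c _ _)
    (Comp.projSlice_eigenPoint hR c _ _) _ _ i
  compB := fun _ j _ => Comp.recoverCol (Comp.projSlice_eigenPoint hR c _ _)
    (Comp.projSlice_eigenPoint hR c _ _) _ _ j
  compC := fun _ k r => Comp.solveThird
    (fun i _ => Comp.recoverCol_transpose (Comp.projSlice_eigenPoint hR c _ _)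
      (Comp.projSlice_eigenPoint hR c _ _) _ _ i)
    (fun j _ => Comp.recoverCol (Comp.projSlice_eigenPoint hR c _ _)
      (Comp.projSlice_eigenPoint hR c _ _) _ _ j) k r

end stage

/-! ### Correctness for suitable choices and conclusion -/

section solve
variable {I J K R p q : ℕ}

/-- The first form avoids all the hyperplanes orthogonal to the x_W. The second separates the
eigenvalue ratios, which is again avoidance of hyperplanes because the x_W are pairwise not
proportional: c_r with r ∈ W \ W' tells x_W from x_W'. -/
theorem exists_separating_moments {C : Matrix (Fin (q + 1)) (Fin R) ℝ}
    {x : ColSet R q → Fin (q + 1) → ℝ} (hx0 : ∀ W, x W ≠ 0)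
    (hx : ∀ W r, x W ⬝ᵥ C.col r = 0 ↔ r ∈ W.1) :
    ∃ (t₁ : Fin (Fintype.card (ColSet R q) * (q + 1) + 1))
      (t₂ : Fin (Fintype.card {W : ColSet R q × ColSet R q // W.1 ≠ W.2} * (q + 1) + 1)),
      (∀ W, moment (q + 1) t₁ ⬝ᵥ x W ≠ 0) ∧ ∀ W W', W ≠ W' →
        (moment (q + 1) t₂ ⬝ᵥ x W) * (moment (q + 1) t₁ ⬝ᵥ x W') ≠
          (moment (q + 1) t₂ ⬝ᵥ x W') * (moment (q + 1) t₁ ⬝ᵥ x W) := by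
  obtain ⟨t₁, h₁⟩ := exists_moment_ne_zero x hx0 (Nat.lt_succ_self _)
  obtain ⟨t₂, h₂⟩ := exists_moment_ne_zero
    (fun W : {W : ColSet R q × ColSet R q // W.1 ≠ W.2} =>
      (moment (q + 1) t₁ ⬝ᵥ x W.1.2) • x W.1.1 - (moment (q + 1) t₁ ⬝ᵥ x W.1.1) • x W.1.2) (by
      rintro ⟨⟨W, W'⟩, hWW⟩ h0
      obtain ⟨r, hr, hr'⟩ := exists_mem_notMem_of_card_eq hWW
      have := congrArg (· ⬝ᵥ C.col r) h0
      simp only [sub_dotProduct, smul_dotProduct, zero_dotProduct, (hx W r).2 hr, smul_eq_mul,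
        mul_zero, zero_sub, neg_eq_zero] at this
      exact mul_ne_zero (h₁ W) (fun h => hr' ((hx W' r).1 h)) this) (Nat.lt_succ_self _)
  refine ⟨t₁, t₂, h₁, fun W W' hWW h => h₂ ⟨(W, W'), hWW⟩ ?_⟩
  simp only [dotProduct_sub, dotProduct_smul, smul_eq_mul]
  linear_combination h

/-- The unknown scaling of the points x_W is harmless, since the recovery of a column uses only
which weights vanish. -/
theorem exists_factorChoice (hR : R = p + q) (hp : 1 ≤ p) (hq : 1 ≤ q)
    {A : Matrix (Fin I) (Fin R) ℝ} {B : Matrix (Fin J) (Fin R) ℝ} (hsep : Separates (p + 1) A B)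
    (C : Matrix (Fin K) (Fin R) ℝ) (c : PencilChoice I J K R p q)
    {x : ColSet R q → Fin (q + 1) → ℝ}
    (hx : ∀ W r, x W ⬝ᵥ (momentMatrix K c.1 * C).col r = 0 ↔ r ∈ W.1)
    (V : Matrix (Fin (Fintype.card (ColSet R q))) (Fin (Fintype.card (ColSet R q))) ℝ)
    (ρ : Fin (Fintype.card (ColSet R q)) → Fin (Fintype.card (ColSet R q)))
    (hρ : ∀ W, ∃ i, ∃ μ : ℝ, μ ≠ 0 ∧
      eigenPoint hR c ρ (polyadic A B C) V i = μ • x W) :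
    ∃ g : FactorChoice I J R p (Fintype.card (ColSet R q)),
      polyadic (factorA hR c g (polyadic A B C) V) (factorB hR c g (polyadic A B C) V)
        (solveThird (factorA hR c g (polyadic A B C) V) (factorB hR c g (polyadic A B C) V)
          (polyadic A B C)) = polyadic A B C := by
  classical
  have hslice : ∀ W : ColSet R q, ∃ i, ∃ d : Fin R → ℝ, (∀ s, d s = 0 ↔ s ∈ W.1) ∧
      projSlice c.1 (polyadic A B C) (eigenPoint hR c ρ (polyadic A B C) V i) =
        weighted A B d := by
    intro W
    obtain ⟨i, μ, hμ, hi⟩ := hρ W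
    refine ⟨i, fun r => (μ • x W) ⬝ᵥ (momentMatrix K c.1 * C).col r, fun s => ?_, ?_⟩
    · simp only [smul_dotProduct, smul_eq_mul]
      rw [mul_eq_zero, or_iff_right hμ, hx]
    · rw [hi, projSlice, slice_polyadic_vecMul]
  have hcol : ∀ r : Fin R, ∃ (ii : _ × _) (PQ : (Fin (p + 1) → Fin I) × (Fin (p + 1) → Fin J))
      (PQ' : (Fin (p + 1) → Fin J) × (Fin (p + 1) → Fin I)) (α β : ℝ), α ≠ 0 ∧ β ≠ 0 ∧
      (∀ j, recoverCol (projSlice c.1 (polyadic A B C) (eigenPoint hR c ρ (polyadic A B C) V ii.1))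
        (projSlice c.1 (polyadic A B C) (eigenPoint hR c ρ (polyadic A B C) V ii.2))
        PQ.1 PQ.2 j = β * B j r) ∧
      (∀ i, recoverCol
        (projSlice c.1 (polyadic A B C) (eigenPoint hR c ρ (polyadic A B C) V ii.1))ᵀ
        (projSlice c.1 (polyadic A B C) (eigenPoint hR c ρ (polyadic A B C) V ii.2))ᵀ
        PQ'.1 PQ'.2 i = α * A i r) := by
    intro r
    obtain ⟨e, he, rfl⟩ := exists_injective_fin_zero (m := p) r (by omega)
    obtain ⟨i', d', hd', hi'⟩ := hslice ⟨complErase e 0, card_complErase hR he 0⟩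
    obtain ⟨i, d, hd, hi⟩ := hslice ⟨complErase e (Fin.last p), card_complErase hR he _⟩
    have hw : weight d' < p + 1 := by
      have : (Finset.univ.filter fun r => d' r ≠ 0) = (complErase e 0)ᶜ := by ext r; simp [hd']
      rw [weight, this, Finset.card_compl, card_complErase hR he, Fintype.card_fin]
      omega
    obtain ⟨P, Q, β, hβ, hB⟩ := exists_recoverCol hsep he hp hd' hd hw
    obtain ⟨P', Q', α, hα, hA⟩ := exists_recoverCol hsep.swap he hp hd' hd hw
    refine ⟨(i', i), (P, Q), (P', Q'), α, β, hα, hβ, fun j => ?_, fun j => ?_⟩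
    · simp only [hi', hi]
      exact hB j
    · simp only [hi', hi, weighted_transpose]
      exact hA j
  choose ii PQ PQ' α β hα hβ hB hA using hcol
  exact ⟨(ρ, ii, PQ, PQ'), polyadic_solveThird hsep (by omega) (by omega) C hα hβ
    (fun i r => hA r i) (fun j r => hB r j)⟩

/-- For every ℓ, the pencil applied to the eigenvector belonging to W is (ℓ·x_W) times a fixed
nonzero multiple of a column of H⁻¹. One nonzero entry of it, read for ℓ running through the unit
vectors, gives the coordinates of x_W up to scaling. -/
theorem exists_pencilStage_solves (hR : R = p + q) (hp : 1 ≤ p) (hq : 1 ≤ q)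
    {A : Matrix (Fin I) (Fin R) ℝ} {B : Matrix (Fin J) (Fin R) ℝ} (hsep : Separates (p + 1) A B)
    (C : Matrix (Fin K) (Fin R) ℝ) (hC : q + 1 ≤ kRank C) :
    ∃ c : PencilChoice I J K R p q, (pencilStage hR c).Solves (polyadic A B C) := by
  obtain ⟨t, ht⟩ := exists_momentMatrix_genPos C hC (Nat.lt_succ_self _)
  choose x hx0 hx using fun W : ColSet R q => ht.exists_point W.1 W.2
  obtain ⟨t₁, t₂, h₁, h₂⟩ := exists_separating_moments hx0 hx
  obtain ⟨sel, ysel, H, F, hH, hF, hHF⟩ := exists_pencil_factorization (samplePointsReal hR) hR hp hq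
    hsep ht hx h₁ (eq_zero_of_samplePoints hR)
    (Fintype.equivOfCardEq (card_sym_eq_card_colSet hR))
  let c : PencilChoice I J K R p q := (t, sel, ysel, t₁, t₂)
  refine ⟨c, ?_⟩
  set T := polyadic A B C with hT
  let eW := Fintype.equivFin (ColSet R q)
  let H' := H.submatrix eW.symm eW.symm
  let F' := F.submatrix eW.symm eW.symm
  have hH' : H'.det ≠ 0 := by rwa [det_submatrix_equiv_self]
  have hF' : F'.det ≠ 0 := by rwa [det_submatrix_equiv_self]
  have hfac : ∀ ℓ, H' * finPencil hR c T ℓ = diagonal (fun i => ℓ ⬝ᵥ x (eW.symm i)) * F' := by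
    intro ℓ
    have hM : projSlice t T = fun y => weighted A B (fun r => y ⬝ᵥ (momentMatrix K t * C).col r) :=
      funext fun y => slice_polyadic_vecMul A B C _ y
    have h3 := congrArg (fun M => M.submatrix eW.symm eW.symm) (hHF ℓ)
    simp only [← hM] at h3
    rw [← submatrix_mul_equiv _ _ _ eW.symm, ← submatrix_mul_equiv _ _ _ eW.symm,
      submatrix_diagonal_equiv] at h3
    exact h3
  obtain ⟨hex, hall⟩ := gevd_of_factorization hH' hF' (hfac (moment (q + 1) t₂))
    (hfac (moment (q + 1) t₁)) (fun i => h₁ _)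
    (fun i j hij => h₂ _ _ (fun h => hij (eW.symm.injective h)))
  refine ⟨hex, fun (V : Matrix (Fin (Fintype.card (ColSet R q)))
    (Fin (Fintype.card (ColSet R q))) ℝ) α β hV => ?_⟩
  obtain ⟨τ, g, hτ, hg, hFV⟩ := hall V α β hV
  -- An invertible matrix has no zero column. The position of a nonzero entry is unknown to the
  -- program and is one of the guesses made after the GEVD.
  have hHinv : ∀ i, ∃ a, H'⁻¹ a i ≠ 0 := by
    intro i
    by_contra hcon
    push Not at hcon
    have h0 := det_eq_zero_of_column_eq_zero i hcon
    rw [det_nonsing_inv, Ring.inverse_eq_inv'] at h0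
    exact hH' (inv_eq_zero.1 h0)
  choose ρ₀ hρ₀ using hHinv
  have hPV : ∀ ℓ a i, (finPencil hR c T ℓ * V) a i =
      (H'⁻¹ a (τ i) * g i) * (ℓ ⬝ᵥ x (eW.symm (τ i))) := by
    intro ℓ a i
    have h3 : finPencil hR c T ℓ * V = H'⁻¹ * (diagonal (fun i => ℓ ⬝ᵥ x (eW.symm i)) * (F' * V)) := by
      rw [← Matrix.mul_assoc (diagonal _), ← hfac, Matrix.mul_assoc H',
        nonsing_inv_mul_cancel_left _ _ hH'.isUnit]
    rw [h3, Matrix.mul_apply, Finset.sum_eq_single (τ i)]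
    · rw [diagonal_mul, hFV, if_pos rfl]; ring
    · intro b _ hb
      rw [diagonal_mul, hFV, if_neg hb]; ring
    · simp
  refine exists_factorChoice hR hp hq hsep C c hx V (fun i => ρ₀ (τ i)) fun W => ?_
  obtain ⟨i, hi⟩ := hτ.2 (eW W)
  refine ⟨i, _, mul_ne_zero (hρ₀ (τ i)) (hg i), ?_⟩
  ext k
  rw [eigenPoint, hPV, single_dotProduct, one_mul, hi, Equiv.symm_apply_apply]
  rfl

/-- Since k_A and r_B are at most R, the first inequality gives k_C ≥ 2, hence q ≥ 1; k_C ≤ R gives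
p ≥ 1. -/
theorem exists_parameters {A : Matrix (Fin I) (Fin R) ℝ} {B : Matrix (Fin J) (Fin R) ℝ}
    {C : Matrix (Fin K) (Fin R) ℝ} (h₁ : kRank A + B.rank + kRank C ≥ 2 * R + 2)
    (h₂ : kRank B + kRank C ≥ R + 2) :
    1 ≤ kRank C - 1 ∧ 1 ≤ R - (kRank C - 1) ∧ R = R - (kRank C - 1) + (kRank C - 1) ∧
      Separates (R - (kRank C - 1) + 1) A B ∧ kRank C - 1 < R := by
  have hA := (kRank_mem A).1
  have hC := (kRank_mem C).1
  have hB : B.rank ≤ R := by simpa using B.rank_le_card_width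
  exact ⟨by omega, by omega, by omega, separates_of_kRank A B (by omega) (by omega), by omega⟩

theorem tensorRank_eq_and_cpdUnique (A : Matrix (Fin I) (Fin R) ℝ) (B : Matrix (Fin J) (Fin R) ℝ)
    (C : Matrix (Fin K) (Fin R) ℝ) (h₁ : kRank A + B.rank + kRank C ≥ 2 * R + 2)
    (h₂ : kRank B + kRank C ≥ R + 2) :
    tensorRank (polyadic A B C) = R ∧ CPDUnique (polyadic A B C) := by
  obtain ⟨hq, hp, hR, hsep, -⟩ := exists_parameters h₁ h₂
  obtain ⟨t, ht⟩ := exists_momentMatrix_genPos (k := kRank C - 1 + 1) C (by omega)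
    (Nat.lt_succ_self _)
  exact ⟨tensorRank_polyadic hR hp hq hsep _ ht, cpdUnique_polyadic hR hp hq hsep _ ht⟩

theorem cpdFoundAlgebraically_of_kRank (I J K R : ℕ) :
    CPDFoundAlgebraically R {T : Tensor I J K | ∃ (A : Matrix (Fin I) (Fin R) ℝ)
      (B : Matrix (Fin J) (Fin R) ℝ) (C : Matrix (Fin K) (Fin R) ℝ), T = polyadic A B C ∧
        kRank A + B.rank + kRank C ≥ 2 * R + 2 ∧ kRank B + kRank C ≥ R + 2} := by
  have hR : ∀ q : Fin R, R = R - (q : ℕ) + q := fun q => by omega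
  -- The number k_C is not part of the input, so the search also runs over all q < R.
  refine cpdFoundAlgebraically_of_stages
    (G := Σ q : Fin R, PencilChoice I J K R (R - (q : ℕ)) q)
    (fun g => pencilStage (hR g.1) g.2) _ ?_ ?_
  · rintro T ⟨A, B, C, rfl, h₁, h₂⟩
    exact (tensorRank_eq_and_cpdUnique A B C h₁ h₂).1
  · rintro T ⟨A, B, C, rfl, h₁, h₂⟩
    obtain ⟨hq, hp, hR', hsep, hlt⟩ := exists_parameters h₁ h₂
    obtain ⟨c, hc⟩ := exists_pencilStage_solves hR' hp hq hsep C (by omega)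
    exact ⟨⟨⟨kRank C - 1, hlt⟩, c⟩, hc⟩

end solve

end CPDecomp


theorem corollary1p8 (I J K R : ℕ) :
    (∀ (A : Matrix (Fin I) (Fin R) ℝ) (B : Matrix (Fin J) (Fin R) ℝ)
        (C : Matrix (Fin K) (Fin R) ℝ),
      CPDecomp.kRank A + B.rank + CPDecomp.kRank C ≥ 2 * R + 2 →
      CPDecomp.kRank B + CPDecomp.kRank C ≥ R + 2 →
      CPDecomp.tensorRank (CPDecomp.polyadic A B C) = R ∧
        CPDecomp.CPDUnique (CPDecomp.polyadic A B C)) ∧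
    CPDecomp.CPDFoundAlgebraically R
      {T : CPDecomp.Tensor I J K |
        ∃ (A : Matrix (Fin I) (Fin R) ℝ) (B : Matrix (Fin J) (Fin R) ℝ)
          (C : Matrix (Fin K) (Fin R) ℝ),
          T = CPDecomp.polyadic A B C ∧
          CPDecomp.kRank A + B.rank + CPDecomp.kRank C ≥ 2 * R + 2 ∧
          CPDecomp.kRank B + CPDecomp.kRank C ≥ R + 2} :=
  ⟨CPDecomp.tensorRank_eq_and_cpdUnique, CPDecomp.cpdFoundAlgebraically_of_kRank I J K R⟩
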